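/- Let $\Lambda$ be a random Borel measure on $\mathbb R$, i.e. a random element of the space of Borel measures on $\mathbb R$ with the $\sigma$-algebra generated by the evaluations $\mu\mapsto\mu(B)$, $B$ Borel. Suppose that $\Lambda$ is stationary, normalized by $\mathbb E[\Lambda([0,1])]=1$, and ergodic, i.e. $\mathbb P(\Lambda\in E)\in\{0,1\}$ for every measurable translation-invariant set $E$ of measures. Let $\lambda>0$ and let $X=(X_i)_{i\in I}$ be a Cox point process with intensity measure $\lambda\Lambda$, i.e. conditionally on $\Lambda$, $X$ is a Poisson point process with intensity measure $\lambda\Lambda$. Let the points $X_i$ carry i.i.d. radii $\varrho_i\ge 0$, independent of $X$ and distributed as a random variable $\varrho$, and let $\mathcal C=\bigcup_{i\in I}B_{\varrho_i}(X_i)$ be the associated Boolean model, where $B_r(x)=\{y\in\mathbb R:|x-y|<r\}$. If $\mathbb E[\varrho]<\infty$, then almost surely $\mathcal C$ has no unbounded connected component. -/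

import Mathlib

open MeasureTheory ProbabilityTheory
open scoped NNReal ENNReal

noncomputable section

/-- The translate by `x` of a measure on the line. -/
def translateMeasure (x : ℝ) (m : Measure ℝ) : Measure ℝ := m.map (fun y => y + x)

/-- A random measure on the line (a random element of `Measure ℝ`, which carries the σ-algebra
generated by the evaluations `m ↦ m B`, `B` Borel) is stationary if its law is invariant under
all translations. -/
structure IsStationaryRandomMeasure {Ω : Type*} [MeasurableSpace Ω]
    (Λ : Ω → Measure ℝ) (P : Measure Ω) : Prop where
  measurable : Measurable Λ
  map_translate : ∀ x : ℝ, P.map (fun ω => translateMeasure x (Λ ω)) = P.map Λ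

/-- A stationary random measure is ergodic if every measurable set of measures which is invariant
under all translations has probability `0` or `1`. -/
structure IsErgodicRandomMeasure {Ω : Type*} [MeasurableSpace Ω]
    (Λ : Ω → Measure ℝ) (P : Measure Ω) : Prop extends IsStationaryRandomMeasure Λ P where
  zero_or_one : ∀ E : Set (Measure ℝ), MeasurableSet E → (∀ x : ℝ, translateMeasure x ⁻¹' E = E) →
    P (Λ ⁻¹' E) = 0 ∨ P (Λ ⁻¹' E) = 1

/-- `Q` is the law of a Poisson point process with intensity measure `μ`, a point process being
identified with its counting measure: the number of points in a Borel set of finite `μ`-measure is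
Poisson distributed with parameter the `μ`-measure of the set, and the numbers of points in
finitely many pairwise disjoint Borel sets are independent. -/
structure IsPoissonLaw (μ : Measure ℝ) (Q : Measure (Measure ℝ)) : Prop where
  isProbabilityMeasure : IsProbabilityMeasure Q
  hasLaw_count : ∀ B : Set ℝ, MeasurableSet B → μ B ≠ ∞ →
    HasLaw (fun η : Measure ℝ => η B)
      ((poissonMeasure (μ B).toNNReal).map (fun n : ℕ => (n : ℝ≥0∞))) Q
  iIndepFun_count : ∀ (n : ℕ) (B : Fin n → Set ℝ), (∀ j, MeasurableSet (B j)) →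
    Pairwise (fun i j => Disjoint (B i) (B j)) →
    iIndepFun (fun (j : Fin n) (η : Measure ℝ) => η (B j)) Q

/-- `N` is (the counting measure of) a Cox point process with random intensity measure `M`:
conditionally on `M`, it is a Poisson point process with intensity measure `M`. -/
def IsCoxProcess {Ω : Type*} [MeasurableSpace Ω]
    (N M : Ω → Measure ℝ) (P : Measure Ω) : Prop :=
  ∃ κ : Kernel (Measure ℝ) (Measure ℝ), IsMarkovKernel κ ∧ HasCondDistrib N M κ P ∧
    ∀ᵐ m ∂(P.map M), IsPoissonLaw m (κ m)

/-- The counting measure of the points `X i`, `i ∈ I`. -/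
def countingMeasure (I : Set ℕ) (X : ℕ → ℝ) : Measure ℝ :=
  Measure.sum (fun i : I => Measure.dirac (X i))

/-- The points `(X i)`, with `i` in the random index set `I`, carry i.i.d. marks `ρ i` with
distribution `ν`, independent of the points. -/
structure IsIIDMarking {Ω : Type*} [MeasurableSpace Ω] (I : Ω → Set ℕ) (X : ℕ → Ω → ℝ)
    (ρ : ℕ → Ω → ℝ≥0) (ν : Measure ℝ≥0) (P : Measure Ω) : Prop where
  measurable_index : Measurable I
  measurable_point : ∀ i, Measurable (X i)
  measurable_mark : ∀ i, Measurable (ρ i)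
  hasLaw_mark : ∀ i, HasLaw (ρ i) ν P
  iIndepFun_mark : iIndepFun ρ P
  indepFun_point_mark : IndepFun (fun ω => (I ω, fun i => X i ω)) (fun ω i => ρ i ω) P

/-- The union of the balls with centre `X i` and radius `r i`, over `i ∈ I`. -/
def booleanModel (I : Set ℕ) (X : ℕ → ℝ) (r : ℕ → ℝ≥0) : Set ℝ :=
  ⋃ i ∈ I, Metric.ball (X i) (r i : ℝ)

/-- The set `C` has an unbounded connected component. -/
def HasUnboundedComponent (C : Set ℝ) : Prop :=
  ∃ x ∈ C, ¬ Bornology.IsBounded (connectedComponentIn C x)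

end

/-! An unbounded component contains a half-line, and then the proportion of vacant length in the
interval from `0` to `σ * n` tends to `0` for `σ = 1` or `σ = -1`. The proof shows that almost
surely this fails.

Write `M` for the intensity `λΛ`. Given `M`, the point `y` is vacant with probability `vacancy ν y
M`, the exponential of minus `∫ M(B_r(y)) dν(r)`. By stationarity this integral has mean at most `2λ
E[ϱ] < ∞`, so the vacancy probability is almost surely positive.

Given `M`, the vacancies of `y` and `z` have covariance at most `∫ M(B_r(y) ∩ B_r(z)) dν(r)`
(`pairVacancy_le`). The mean of this bound tends to `0` as `|y - z| → ∞`, again because `E[ϱ] < ∞`.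
A second-moment argument (`exists_seq_tendsto_ae_average`) then gives a subsequence along which the
vacant proportion minus its conditional mean `meanVacancy` tends to `0` almost surely.

Translating `M` by `x` changes `meanVacancy` by at most `2|x|/n`, so the event that it tends to `0`
along the subsequence is invariant and has probability `0` or `1`. Probability `1` is impossible,
since its expectation is a positive constant (`IsErgodicRandomMeasure.ae_not_tendsto_meanVacancy`).
No ergodic theorem is needed. -/

/-- The function `t ↦ exp (-t)` on `[0, ∞]`. -/
noncomputable def expNeg (t : ℝ≥0∞) : ℝ≥0∞ := EReal.exp (-(t : EReal))

/-- The inverse `p ↦ -log p` of `expNeg` on `[0, 1]`. -/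
noncomputable def negLog (p : ℝ≥0∞) : ℝ≥0∞ := (-(ENNReal.log p)).toENNReal

@[simp] lemma expNeg_zero : expNeg 0 = 1 := by simp [expNeg]

@[simp] lemma expNeg_top : expNeg ∞ = 0 := by simp [expNeg]

lemma expNeg_add (s t : ℝ≥0∞) : expNeg (s + t) = expNeg s * expNeg t := by
  rw [expNeg, expNeg, expNeg, ← EReal.exp_add, EReal.coe_ennreal_add, EReal.neg_add, sub_eq_add_neg]
  · left; simp
  · right; simp

lemma expNeg_coe (t : ℝ≥0) : expNeg t = ENNReal.ofReal (Real.exp (-t)) := by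
  rw [expNeg]
  exact EReal.exp_coe (-(t : ℝ))

lemma expNeg_antitone : Antitone expNeg := fun _ _ h ↦
  EReal.exp_monotone (EReal.neg_le_neg_iff.2 (EReal.coe_ennreal_le_coe_ennreal_iff.2 h))

lemma expNeg_le_one (t : ℝ≥0∞) : expNeg t ≤ 1 := by
  simpa using expNeg_antitone (zero_le (a := t))

lemma expNeg_ne_top (t : ℝ≥0∞) : expNeg t ≠ ∞ :=
  ((expNeg_le_one t).trans_lt ENNReal.one_lt_top).ne

lemma expNeg_eq_zero_iff {t : ℝ≥0∞} : expNeg t = 0 ↔ t = ∞ := by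
  simp [expNeg]

lemma continuous_expNeg : Continuous expNeg :=
  ENNReal.continuous_exp.comp (continuous_neg.comp continuous_coe_ennreal_ereal)

@[fun_prop]
lemma measurable_expNeg : Measurable expNeg := continuous_expNeg.measurable

lemma expNeg_sum {ι : Type*} (s : Finset ι) (f : ι → ℝ≥0∞) :
    expNeg (∑ i ∈ s, f i) = ∏ i ∈ s, expNeg (f i) := by
  classical
  induction s using Finset.induction_on with
  | empty => simp
  | insert a s ha ih => rw [Finset.sum_insert ha, Finset.prod_insert ha, expNeg_add, ih]

lemma expNeg_mul_nat (c : ℝ≥0∞) (n : ℕ) : expNeg (c * n) = expNeg c ^ n := by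
  rw [mul_comm, ← nsmul_eq_mul, ← Finset.card_range n, ← Finset.sum_const, expNeg_sum]
  simp

lemma one_sub_expNeg_le (t : ℝ≥0∞) : 1 - expNeg t ≤ t := by
  induction t using ENNReal.recTopCoe with
  | top => simp
  | coe t =>
    rw [expNeg_coe, ← ENNReal.ofReal_one, ← ENNReal.ofReal_sub _ (Real.exp_pos _).le,
      ← ENNReal.ofReal_coe_nnreal]
    exact ENNReal.ofReal_le_ofReal (by linarith [Real.add_one_le_exp (-(t : ℝ))])

lemma expNeg_negLog {p : ℝ≥0∞} (hp : p ≤ 1) : expNeg (negLog p) = p := by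
  rw [expNeg, negLog, EReal.coe_toENNReal, neg_neg, ENNReal.exp_log]
  rw [← EReal.neg_le_neg_iff]
  simpa using hp

@[fun_prop]
lemma measurable_negLog : Measurable negLog := by
  unfold negLog
  fun_prop

/-! ### Laplace functional of a Poisson process -/

/-- This is the Poisson generating function evaluated at `q = expNeg c`; the value `c = ∞`, that is
`q = 0`, is included. -/
lemma lintegral_expNeg_poissonMeasure (c : ℝ≥0∞) (r : ℝ≥0) :
    ∫⁻ n, expNeg (c * n) ∂(poissonMeasure r) = expNeg ((1 - expNeg c) * r) := by
  rw [lintegral_countable']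
  simp_rw [expNeg_mul_nat, poissonMeasure_singleton]
  obtain ⟨q, hq⟩ : ∃ q : ℝ≥0, expNeg c = q := ⟨(expNeg c).toNNReal,
    (ENNReal.coe_toNNReal (expNeg_ne_top c)).symm⟩
  have hq1 : q ≤ 1 := by exact_mod_cast hq ▸ expNeg_le_one c
  rw [hq]
  have h1 : ∀ n : ℕ, (q : ℝ≥0∞) ^ n * ENNReal.ofReal (Real.exp (-r) * r ^ n / n.factorial) =
      ENNReal.ofReal (Real.exp (-r) * ((q * r : ℝ) ^ n / n.factorial)) := by
    intro n
    rw [← ENNReal.coe_pow, ← ENNReal.ofReal_coe_nnreal, ← ENNReal.ofReal_mul (by positivity)]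
    congr 1
    push_cast
    ring
  simp_rw [h1]
  have hs : HasSum (fun n : ℕ ↦ (q * r : ℝ) ^ n / n.factorial) (Real.exp (q * r)) := by
    rw [Real.exp_eq_exp_ℝ]
    exact NormedSpace.expSeries_div_hasSum_exp (q * r : ℝ)
  have hs' := hs.mul_left (Real.exp (-r))
  rw [← ENNReal.ofReal_tsum_of_nonneg (fun n ↦ by positivity) hs'.summable, hs'.tsum_eq,
    ← Real.exp_add]
  have : (1 - (q : ℝ≥0∞)) * r = ((1 - q) * r : ℝ≥0) := by push_cast; rfl
  rw [this, expNeg_coe]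
  congr 2
  push_cast [NNReal.coe_sub hq1]
  ring

namespace IsPoissonLaw

variable {m : Measure ℝ} {Q : Measure (Measure ℝ)}

lemma lintegral_expNeg_mul_apply (h : IsPoissonLaw m Q) {B : Set ℝ} (hB : MeasurableSet B)
    (hmB : m B ≠ ∞) (c : ℝ≥0∞) :
    ∫⁻ η, expNeg (c * η B) ∂Q = expNeg ((1 - expNeg c) * m B) := by
  have hl := h.hasLaw_count B hB hmB
  have h1 := hl.lintegral_comp (f := fun t ↦ expNeg (c * t))
    (by fun_prop)
  rw [h1, lintegral_map (by fun_prop) (by fun_prop), lintegral_expNeg_poissonMeasure,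
    ENNReal.coe_toNNReal hmB]

/-- The level sets of `f` are disjoint, so their counts are independent and the expectation
factorizes. The level `0` contributes a factor `1` on both sides, so its mass may be infinite. -/
lemma lintegral_expNeg_simpleFunc (h : IsPoissonLaw m Q) (f : SimpleFunc ℝ ℝ≥0∞)
    (hf : ∀ c ≠ 0, m (f ⁻¹' {c}) ≠ ∞) :
    ∫⁻ η, expNeg (∫⁻ x, f x ∂η) ∂Q = expNeg (∫⁻ x, (1 - expNeg (f x)) ∂m) := by
  have := h.isProbabilityMeasure
  set n := f.range.card
  let e : Fin n ≃ f.range := f.range.equivFin.symm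
  let B : Fin n → Set ℝ := fun j ↦ f ⁻¹' {(e j : ℝ≥0∞)}
  have hB : ∀ j, MeasurableSet (B j) := fun j ↦ f.measurableSet_fiber _
  have hdisj : Pairwise (fun i j ↦ Disjoint (B i) (B j)) := by
    intro i j hij
    refine Disjoint.preimage f ?_
    rw [Set.disjoint_singleton]
    exact fun h ↦ hij (e.injective (Subtype.ext h))
  have hind := h.iIndepFun_count n B hB hdisj
  have hint : ∀ (g : ℝ≥0∞ → ℝ≥0∞) (η : Measure ℝ),
      ∫⁻ x, g (f x) ∂η = ∑ j, g (e j) * η (B j) := by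
    intro g η
    have h1 : ∫⁻ x, g (f x) ∂η = ∑ c ∈ f.range, g c * η (f ⁻¹' {c}) := by
      rw [← SimpleFunc.map_lintegral, ← SimpleFunc.lintegral_eq_lintegral]
      rfl
    rw [h1, ← Finset.sum_coe_sort, ← e.sum_comp]
  rw [hint (fun c ↦ 1 - expNeg c)]
  have h2 : ∀ η : Measure ℝ, expNeg (∫⁻ x, f x ∂η) = ∏ j, expNeg (e j * η (B j)) := by
    intro η
    rw [hint (fun c ↦ c), expNeg_sum]
  simp_rw [h2]
  have hind' := hind.comp (fun j t ↦ expNeg (e j * t)) (fun j ↦ by fun_prop)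
  have hmeas : ∀ j, Measurable ((fun t ↦ expNeg (e j * t)) ∘ fun η : Measure ℝ ↦ η (B j)) :=
    fun j ↦ (by fun_prop : Measurable (fun t ↦ expNeg (e j * t))).comp
      (Measure.measurable_coe (hB j))
  have h3 := lintegral_prod_eq_prod_lintegral_of_indepFun Finset.univ _ hind' hmeas
  simp only [Function.comp_apply] at h3
  rw [h3, expNeg_sum]
  refine Finset.prod_congr rfl fun j _ ↦ ?_
  by_cases hj : (e j : ℝ≥0∞) = 0
  · simp [hj]
  · exact h.lintegral_expNeg_mul_apply (hB j) (hf _ hj) _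

/-- The Laplace functional of a Poisson point process. -/
theorem lintegral_expNeg_lintegral (h : IsPoissonLaw m Q) [IsLocallyFiniteMeasure m]
    {f : ℝ → ℝ≥0∞} (hf : Measurable f) :
    ∫⁻ η, expNeg (∫⁻ x, f x ∂η) ∂Q = expNeg (∫⁻ x, (1 - expNeg (f x)) ∂m) := by
  have := h.isProbabilityMeasure
  let s : ℕ → Set ℝ := fun n ↦ Set.Icc (-(n : ℝ)) n
  -- Cutting off outside a compact window gives every nonzero level finite `m`-mass.
  let g : ℕ → SimpleFunc ℝ ℝ≥0∞ := fun n ↦ (SimpleFunc.eapprox f n).restrict (s n)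
  have hs : ∀ n, MeasurableSet (s n) := fun n ↦ measurableSet_Icc
  have hs_mono : Monotone s := fun a b hab ↦
    Set.Icc_subset_Icc (by simpa using hab) (by simpa using hab)
  have hg_apply : ∀ n x, g n x = (s n).indicator (SimpleFunc.eapprox f n) x := fun n x ↦
    SimpleFunc.restrict_apply _ (hs n) x
  have hg_mono : Monotone (fun n x ↦ g n x) := by
    intro a b hab x
    simp only [hg_apply]
    calc (s a).indicator (SimpleFunc.eapprox f a) x
        ≤ (s a).indicator (SimpleFunc.eapprox f b) x :=
          Set.indicator_le_indicator (SimpleFunc.monotone_eapprox f hab x)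
      _ ≤ (s b).indicator (SimpleFunc.eapprox f b) x :=
          Set.indicator_le_indicator_of_subset (hs_mono hab) (fun _ ↦ zero_le) x
  have hg_lim : ∀ x, Filter.Tendsto (fun n ↦ g n x) Filter.atTop (nhds (f x)) := by
    intro x
    have h1 : Filter.Tendsto (fun n ↦ SimpleFunc.eapprox f n x) Filter.atTop (nhds (f x)) :=
      SimpleFunc.tendsto_eapprox hf x
    refine h1.congr' ?_
    obtain ⟨N, hN⟩ := exists_nat_ge |x|
    filter_upwards [Filter.eventually_ge_atTop N] with n hn
    rw [hg_apply, Set.indicator_of_mem]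
    have : (N : ℝ) ≤ n := by exact_mod_cast hn
    exact abs_le.1 (hN.trans this)
  have hfin : ∀ n, ∀ c ≠ 0, m (g n ⁻¹' {c}) ≠ ∞ := by
    intro n c hc
    refine ne_top_of_le_ne_top (isCompact_Icc (a := -(n : ℝ)) (b := n)).measure_lt_top.ne
      (measure_mono fun x hx ↦ ?_)
    by_contra hxs
    exact hc (by rw [← (hx : g n x = c), hg_apply, Set.indicator_of_notMem hxs])
  have hmono2 : ∀ η : Measure ℝ, Filter.Tendsto (fun n ↦ ∫⁻ x, g n x ∂η) Filter.atTop
      (nhds (∫⁻ x, f x ∂η)) := fun η ↦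
    lintegral_tendsto_of_tendsto_of_monotone (fun n ↦ (g n).measurable.aemeasurable)
      (Filter.Eventually.of_forall fun x a b hab ↦ hg_mono hab x)
      (Filter.Eventually.of_forall hg_lim)
  have hL : Filter.Tendsto (fun n ↦ ∫⁻ η, expNeg (∫⁻ x, g n x ∂η) ∂Q) Filter.atTop
      (nhds (∫⁻ η, expNeg (∫⁻ x, f x ∂η) ∂Q)) := by
    refine tendsto_lintegral_of_dominated_convergence (fun _ ↦ 1) (fun n ↦ ?_) (fun n ↦ ?_)
      (by simp) (Filter.Eventually.of_forall fun η ↦ ?_)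
    · exact measurable_expNeg.comp (Measure.measurable_lintegral (g n).measurable)
    · exact Filter.Eventually.of_forall fun η ↦ expNeg_le_one _
    · exact (continuous_expNeg.tendsto _).comp (hmono2 η)
  have hR : Filter.Tendsto (fun n ↦ expNeg (∫⁻ x, (1 - expNeg (g n x)) ∂m)) Filter.atTop
      (nhds (expNeg (∫⁻ x, (1 - expNeg (f x)) ∂m))) := by
    refine (continuous_expNeg.tendsto _).comp ?_
    refine lintegral_tendsto_of_tendsto_of_monotone
      (fun n ↦ (measurable_const.sub (measurable_expNeg.comp (g n).measurable)).aemeasurable)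
      (Filter.Eventually.of_forall fun x a b hab ↦ tsub_le_tsub_left
        (expNeg_antitone (hg_mono hab x)) _) (Filter.Eventually.of_forall fun x ↦ ?_)
    exact ENNReal.Tendsto.sub tendsto_const_nhds ((continuous_expNeg.tendsto _).comp (hg_lim x))
      (Or.inl ENNReal.one_ne_top)
  refine tendsto_nhds_unique hL ?_
  simp_rw [fun n ↦ h.lintegral_expNeg_simpleFunc (g n) (hfin n)]
  exact hR

end IsPoissonLaw

/-! ### Translation, scaling and intensity of random measures -/

lemma measurable_translateMeasure (x : ℝ) : Measurable (translateMeasure x) :=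
  Measure.measurable_map _ (measurable_add_const x)

lemma translateMeasure_apply (x : ℝ) (m : Measure ℝ) {B : Set ℝ} (hB : MeasurableSet B) :
    translateMeasure x m B = m ((fun y ↦ y + x) ⁻¹' B) :=
  Measure.map_apply (measurable_add_const x) hB

lemma measurable_const_smul_measure (c : ℝ≥0) :
    Measurable (fun m : Measure ℝ ↦ c • m) := by
  refine Measure.measurable_of_measurable_coe _ fun s hs ↦ ?_
  simp only [Measure.smul_apply, ENNReal.smul_def, smul_eq_mul]
  exact (Measure.measurable_coe hs).const_mul _

lemma translateMeasure_smul (x : ℝ) (c : ℝ≥0) (m : Measure ℝ) :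
    translateMeasure x (c • m) = c • translateMeasure x m :=
  Measure.map_smul ..

section RandomMeasure

variable {Ω : Type*} [MeasurableSpace Ω] {Λ : Ω → Measure ℝ} {P : Measure Ω}

lemma IsErgodicRandomMeasure.const_smul (h : IsErgodicRandomMeasure Λ P) (c : ℝ≥0) :
    IsErgodicRandomMeasure (fun ω ↦ c • Λ ω) P where
  measurable := (measurable_const_smul_measure c).comp h.measurable
  map_translate x := by
    have h1 := congrArg (Measure.map (fun m : Measure ℝ ↦ c • m)) (h.map_translate x)
    rw [Measure.map_map (g := fun m : Measure ℝ ↦ c • m)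
      (f := fun ω ↦ translateMeasure x (Λ ω)) (measurable_const_smul_measure c)
      ((measurable_translateMeasure x).comp h.measurable),
      Measure.map_map (measurable_const_smul_measure c) h.measurable] at h1
    simp_rw [translateMeasure_smul]
    exact h1
  zero_or_one E hE hinv := by
    refine h.zero_or_one ((fun m ↦ c • m) ⁻¹' E) (measurable_const_smul_measure c hE) fun x ↦ ?_
    ext m
    have := Set.ext_iff.1 (hinv x) (c • m)
    rw [Set.mem_preimage, translateMeasure_smul] at this
    exact this

/-- The intensity measure of a stationary random measure with finite intensity is a multiple of
Lebesgue measure. -/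
lemma IsStationaryRandomMeasure.join_map_eq (h : IsStationaryRandomMeasure Λ P) {c : ℝ≥0}
    (hc : ∫⁻ ω, Λ ω (Set.Icc 0 1) ∂P = c) :
    Measure.join (P.map Λ) = (c : ℝ≥0∞) • (volume : Measure ℝ) := by
  set μ := Measure.join (P.map Λ)
  have hμ : ∀ B, MeasurableSet B → μ B = ∫⁻ ω, Λ ω B ∂P := fun B hB ↦ by
    rw [Measure.join_apply hB, lintegral_map (Measure.measurable_coe hB) h.measurable]
  have htrans : ∀ x B, MeasurableSet B → μ ((fun y ↦ y + x) ⁻¹' B) = μ B := by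
    intro x B hB
    rw [hμ _ (measurable_add_const x hB)]
    have h1 : ∀ ω, Λ ω ((fun y ↦ y + x) ⁻¹' B) = translateMeasure x (Λ ω) B :=
      fun ω ↦ (translateMeasure_apply x _ hB).symm
    simp_rw [h1]
    rw [← lintegral_map (f := fun m : Measure ℝ ↦ m B)
      (g := fun ω ↦ translateMeasure x (Λ ω)) (Measure.measurable_coe hB)
      ((measurable_translateMeasure x).comp h.measurable), h.map_translate x,
      ← Measure.join_apply hB]
  have : μ.IsAddLeftInvariant := ⟨fun x ↦ by
    ext B hB
    rw [Measure.map_apply (measurable_const_add x) hB, ← htrans x B hB]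
    simp_rw [add_comm]⟩
  have hIcc : μ (Set.Icc 0 1) = c := by rw [hμ _ measurableSet_Icc, hc]
  have : IsLocallyFiniteMeasure μ := ⟨fun x ↦
    ⟨Set.Icc (x - 1 / 2) (x + 1 / 2), Icc_mem_nhds (by linarith) (by linarith), by
      rw [← htrans (x - 1 / 2) _ measurableSet_Icc]
      have : (fun y ↦ y + (x - 1 / 2)) ⁻¹' Set.Icc (x - 1 / 2) (x + 1 / 2) = Set.Icc 0 1 := by
        ext y
        simp only [Set.mem_preimage, Set.mem_Icc]
        constructor <;> rintro ⟨h1, h2⟩ <;> constructor <;> linarith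
      rw [this, hIcc]
      exact ENNReal.coe_lt_top⟩⟩
  -- Uniqueness of Haar measure; the mass of `[0, 1]` identifies the factor.
  have h2 := Measure.isAddLeftInvariant_eq_smul μ (volume : Measure ℝ)
  set k := Measure.addHaarScalarFactor μ (volume : Measure ℝ)
  have h3 : (k : ℝ≥0∞) = c := by
    rw [← hIcc, h2]
    rw [Measure.smul_apply, Real.volume_Icc]
    simp [ENNReal.smul_def]
  rw [h2, ← h3]
  rfl

lemma IsStationaryRandomMeasure.lintegral_apply (h : IsStationaryRandomMeasure Λ P) {c : ℝ≥0}
    (hc : ∫⁻ ω, Λ ω (Set.Icc 0 1) ∂P = c) {B : Set ℝ} (hB : MeasurableSet B) :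
    ∫⁻ ω, Λ ω B ∂P = c * volume B := by
  rw [← lintegral_map (f := fun m : Measure ℝ ↦ m B) (Measure.measurable_coe hB) h.measurable,
    ← Measure.join_apply hB, h.join_map_eq hc]
  rfl

lemma isLocallyFiniteMeasure_of_forall_Icc {m : Measure ℝ}
    (h : ∀ n : ℕ, m (Set.Icc (-(n : ℝ)) n) < ∞) : IsLocallyFiniteMeasure m := ⟨fun x ↦ by
  obtain ⟨n, hn⟩ := exists_nat_gt |x|
  exact ⟨Set.Icc (-(n : ℝ)) n, Icc_mem_nhds (abs_lt.1 hn).1 (abs_lt.1 hn).2, h n⟩⟩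

lemma IsStationaryRandomMeasure.ae_map_isLocallyFiniteMeasure
    (h : IsStationaryRandomMeasure Λ P) {c : ℝ≥0} (hc : ∫⁻ ω, Λ ω (Set.Icc 0 1) ∂P = c) :
    ∀ᵐ m ∂(P.map Λ), IsLocallyFiniteMeasure m := by
  suffices ∀ᵐ m ∂(P.map Λ), ∀ n : ℕ, m (Set.Icc (-(n : ℝ)) n) < ∞ from
    this.mono fun m hm ↦ isLocallyFiniteMeasure_of_forall_Icc hm
  rw [ae_all_iff]
  intro n
  refine ae_lt_top (Measure.measurable_coe measurableSet_Icc) ?_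
  rw [← Measure.join_apply measurableSet_Icc, h.join_map_eq hc]
  rw [Measure.smul_apply, Real.volume_Icc]
  exact ENNReal.mul_ne_top ENNReal.coe_ne_top ENNReal.ofReal_ne_top

end RandomMeasure

/-! ### Joint measurability of the mass of intervals -/

/-- A countable supremum over fixed sets makes the mass jointly measurable in the measure and the
endpoints. -/
lemma measure_Ioo_eq_iSup_rat (m : Measure ℝ) (a b : ℝ) :
    m (Set.Ioo a b) =
      ⨆ q : ℚ × ℚ, if a < q.1 ∧ (q.2 : ℝ) < b then m (Set.Icc q.1 q.2) else 0 := by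
  let T := {q : ℚ × ℚ // a < q.1 ∧ (q.2 : ℝ) < b}
  have h1 : Set.Ioo a b = ⋃ q : T, Set.Icc (q.1.1 : ℝ) q.1.2 := by
    ext x
    simp only [Set.mem_Ioo, Set.mem_iUnion, Set.mem_Icc]
    constructor
    · rintro ⟨hax, hxb⟩
      obtain ⟨s, hs1, hs2⟩ := exists_rat_btwn hax
      obtain ⟨t, ht1, ht2⟩ := exists_rat_btwn hxb
      exact ⟨⟨(s, t), hs1, ht2⟩, hs2.le, ht1.le⟩
    · rintro ⟨⟨q, hq1, hq2⟩, h1, h2⟩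
      exact ⟨hq1.trans_le h1, h2.trans_lt hq2⟩
  have hdir : Directed (· ⊆ ·) fun q : T ↦ Set.Icc (q.1.1 : ℝ) q.1.2 := by
    rintro ⟨q, hq1, hq2⟩ ⟨q', hq1', hq2'⟩
    refine ⟨⟨(min q.1 q'.1, max q.2 q'.2), ?_, ?_⟩, ?_, ?_⟩
    · push_cast; exact lt_min hq1 hq1'
    · push_cast; exact max_lt hq2 hq2'
    · refine Set.Icc_subset_Icc ?_ ?_ <;> simp
    · refine Set.Icc_subset_Icc ?_ ?_ <;> simp
  rw [h1, hdir.measure_iUnion, iSup_subtype]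
  refine iSup_congr fun q ↦ ?_
  split_ifs with h <;> simp [h]

lemma measurable_measure_Ioo :
    Measurable fun p : Measure ℝ × ℝ × ℝ ↦ p.1 (Set.Ioo p.2.1 p.2.2) := by
  simp_rw [measure_Ioo_eq_iSup_rat]
  refine Measurable.iSup fun q ↦ Measurable.ite ?_ ?_ measurable_const
  · exact (measurableSet_lt (measurable_fst.comp measurable_snd) measurable_const).inter
      (measurableSet_lt measurable_const (measurable_snd.comp measurable_snd))
  · exact (Measure.measurable_coe measurableSet_Icc).comp measurable_fst

lemma measurable_measure_ball :
    Measurable fun p : (Measure ℝ × ℝ) × ℝ≥0 ↦ p.1.1 (Metric.ball p.1.2 (p.2 : ℝ)) := by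
  simp_rw [Real.ball_eq_Ioo]
  exact measurable_measure_Ioo.comp (f := fun p : (Measure ℝ × ℝ) × ℝ≥0 ↦
    (p.1.1, p.1.2 - (p.2 : ℝ), p.1.2 + (p.2 : ℝ))) (by fun_prop)

lemma measurable_measure_ball_inter_ball (y z : ℝ) :
    Measurable fun p : Measure ℝ × ℝ≥0 ↦
      p.1 (Metric.ball y (p.2 : ℝ) ∩ Metric.ball z (p.2 : ℝ)) := by
  simp_rw [Real.ball_eq_Ioo, Set.Ioo_inter_Ioo]
  exact measurable_measure_Ioo.comp (f := fun p : Measure ℝ × ℝ≥0 ↦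
    (p.1, (y - (p.2 : ℝ)) ⊔ (z - (p.2 : ℝ)), (y + (p.2 : ℝ)) ⊓ (z + (p.2 : ℝ)))) (by fun_prop)

/-! ### Vacancy probabilities for a fixed intensity measure -/

/-- The probability that the point `y` is vacant in the Boolean model driven by a Poisson point
process with intensity measure `m`, for the radius distribution `ν`. -/
noncomputable def vacancy (ν : Measure ℝ≥0) (y : ℝ) (m : Measure ℝ) : ℝ≥0∞ :=
  expNeg (∫⁻ r, m (Metric.ball y (r : ℝ)) ∂ν)

/-- The probability that the points `y` and `z` are both vacant in the Boolean model driven by a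
Poisson point process with intensity measure `m`, for the radius distribution `ν`. -/
noncomputable def pairVacancy (ν : Measure ℝ≥0) (y z : ℝ) (m : Measure ℝ) : ℝ≥0∞ :=
  expNeg (∫⁻ x, ν {r | x ∈ Metric.ball y (r : ℝ) ∪ Metric.ball z (r : ℝ)} ∂m)

section Vacancy

variable (ν : Measure ℝ≥0)

lemma vacancy_le_one (y : ℝ) (m : Measure ℝ) : vacancy ν y m ≤ 1 := expNeg_le_one _

lemma measurable_vacancy [SFinite ν] :
    Measurable fun p : Measure ℝ × ℝ ↦ vacancy ν p.2 p.1 :=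
  measurable_expNeg.comp (Measurable.lintegral_prod_right' measurable_measure_ball)

lemma vacancy_translateMeasure (x y : ℝ) (m : Measure ℝ) :
    vacancy ν y (translateMeasure x m) = vacancy ν (y - x) m := by
  unfold vacancy
  congr 1
  refine lintegral_congr fun r ↦ ?_
  rw [translateMeasure_apply _ _ measurableSet_ball]
  congr 1
  ext z
  simp only [Set.mem_preimage, Metric.mem_ball, Real.dist_eq]
  rw [show z + x - y = z - (y - x) by ring]

lemma measurableSet_mem_ball (y : ℝ) :
    MeasurableSet {p : ℝ≥0 × ℝ | p.2 ∈ Metric.ball y (p.1 : ℝ)} :=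
  measurableSet_lt (f := fun p : ℝ≥0 × ℝ ↦ dist p.2 y) (g := fun p ↦ (p.1 : ℝ))
    (by fun_prop) (by fun_prop)

variable {ν}

lemma lintegral_measure_section_eq [SFinite ν] (m : Measure ℝ) [SFinite m]
    {U : ℝ≥0 → Set ℝ} (hU : MeasurableSet {p : ℝ≥0 × ℝ | p.2 ∈ U p.1}) :
    ∫⁻ r, m (U r) ∂ν = ∫⁻ x, ν {r | x ∈ U r} ∂m :=
  (Measure.prod_apply hU).symm.trans (Measure.prod_apply_symm hU)

lemma measurable_measure_section [SFinite ν] {U : ℝ≥0 → Set ℝ}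
    (hU : MeasurableSet {p : ℝ≥0 × ℝ | p.2 ∈ U p.1}) :
    Measurable fun x ↦ ν {r | x ∈ U r} :=
  measurable_measure_prodMk_right hU

lemma pairVacancy_self [SFinite ν] (y : ℝ) (m : Measure ℝ) [SFinite m] :
    pairVacancy ν y y m = vacancy ν y m := by
  simp only [pairVacancy, vacancy, Set.union_self]
  rw [lintegral_measure_section_eq m (measurableSet_mem_ball y)]

/-- Exponentiated form of `m A + m B = m (A ∪ B) + m (A ∩ B)`, integrated over the radius. -/
lemma vacancy_mul_vacancy [SFinite ν] (y z : ℝ) (m : Measure ℝ) [SFinite m] :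
    vacancy ν y m * vacancy ν z m = pairVacancy ν y z m *
      expNeg (∫⁻ r, m (Metric.ball y (r : ℝ) ∩ Metric.ball z (r : ℝ)) ∂ν) := by
  have hy := measurableSet_mem_ball y
  have hz := measurableSet_mem_ball z
  unfold vacancy pairVacancy
  rw [← expNeg_add, ← expNeg_add,
    ← lintegral_measure_section_eq m (U := fun r ↦ Metric.ball y (r : ℝ) ∪ Metric.ball z (r : ℝ))
      (hy.union hz),
    ← lintegral_add_left (f := fun r : ℝ≥0 ↦ m (Metric.ball y r)) (measurable_measure_prodMk_left hy),
    ← lintegral_add_left (f := fun r : ℝ≥0 ↦ m (Metric.ball y r ∪ Metric.ball z r))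
      (measurable_measure_prodMk_left (hy.union hz))]
  congr 1
  exact lintegral_congr fun r ↦ (measure_union_add_inter _ measurableSet_ball).symm

/-- The excess over the product is `pairVacancy` times `1 - expNeg J`, and `1 - expNeg J ≤ J`. -/
lemma pairVacancy_le [SFinite ν] (y z : ℝ) (m : Measure ℝ) [SFinite m] :
    pairVacancy ν y z m ≤ vacancy ν y m * vacancy ν z m +
      ∫⁻ r, m (Metric.ball y (r : ℝ) ∩ Metric.ball z (r : ℝ)) ∂ν := by
  rw [vacancy_mul_vacancy, ← tsub_le_iff_left]
  set J := ∫⁻ r, m (Metric.ball y (r : ℝ) ∩ Metric.ball z (r : ℝ)) ∂ν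
  have hne : pairVacancy ν y z m ≠ ∞ := expNeg_ne_top _
  calc pairVacancy ν y z m - pairVacancy ν y z m * expNeg J
      = pairVacancy ν y z m * (1 - expNeg J) := by
        rw [ENNReal.mul_sub (fun _ _ ↦ hne), mul_one]
    _ ≤ 1 * J := mul_le_mul' (expNeg_le_one _) (one_sub_expNeg_le J)
    _ = J := one_mul J

end Vacancy

/-! ### Integrating out the radii with the points fixed -/

/-- Continuity from above along finite cylinders, with no constraint at indices outside `I`. Writing
the product as `expNeg` of a sum of `negLog` turns it into an integral against the counting measure,
as the Laplace functional requires. -/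
lemma infinitePi_setOf_forall_mem {α : Type*} [MeasurableSpace α] (ν : Measure α)
    [IsProbabilityMeasure ν] (I : Set ℕ) {t : ℕ → Set α} (ht : ∀ i, MeasurableSet (t i)) :
    Measure.infinitePi (fun _ : ℕ ↦ ν) {r | ∀ i ∈ I, r i ∈ t i} =
      expNeg (∑' i : I, negLog (ν (t i))) := by
  classical
  let t' : ℕ → Set α := fun i ↦ if i ∈ I then t i else Set.univ
  have ht' : ∀ i, MeasurableSet (t' i) := fun i ↦ by
    simp only [t']
    split_ifs
    exacts [ht i, MeasurableSet.univ]
  have h1 : {r : ℕ → α | ∀ i ∈ I, r i ∈ t i} =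
      ⋂ n, Set.pi (Finset.range n : Set ℕ) t' := by
    ext r
    simp only [Set.mem_ofPred_eq, Set.mem_iInter, Set.mem_pi, Finset.coe_range, Set.mem_Iio, t']
    constructor
    · intro h n i _
      split_ifs with hi
      exacts [h i hi, trivial]
    · intro h i hi
      simpa [hi] using h (i + 1) i (Nat.lt_succ_self i)
  have hanti : Antitone fun n : ℕ ↦ Set.pi (Finset.range n : Set ℕ) t' := fun a b hab r hr i hi ↦
    hr i (by simp only [Finset.coe_range, Set.mem_Iio] at hi ⊢; omega)
  have hlim := tendsto_measure_iInter_atTop (μ := Measure.infinitePi (fun _ : ℕ ↦ ν))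
    (fun n ↦ (MeasurableSet.pi (Finset.countable_toSet (Finset.range n))
      (fun i _ ↦ ht' i)).nullMeasurableSet) hanti ⟨0, measure_ne_top _ _⟩
  rw [← h1] at hlim
  refine tendsto_nhds_unique hlim ?_
  have h2 : ∀ n : ℕ, Measure.infinitePi (fun _ : ℕ ↦ ν) (Set.pi (Finset.range n : Set ℕ) t') =
      expNeg (∑ i ∈ Finset.range n, I.indicator (fun i ↦ negLog (ν (t i))) i) := by
    intro n
    rw [Measure.infinitePi_pi _ (fun i _ ↦ ht' i), expNeg_sum]
    refine Finset.prod_congr rfl fun i _ ↦ ?_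
    by_cases hi : i ∈ I
    · simp [t', hi, expNeg_negLog prob_le_one]
    · simp [t', hi]
  simp only [Function.comp_def, h2]
  rw [tsum_subtype I (fun i ↦ negLog (ν (t i)))]
  exact (continuous_expNeg.tendsto _).comp (ENNReal.tendsto_nat_tsum _)

lemma mem_booleanModel {I : Set ℕ} {X : ℕ → ℝ} {r : ℕ → ℝ≥0} {y : ℝ} :
    y ∈ booleanModel I X r ↔ ∃ i ∈ I, y ∈ Metric.ball (X i) (r i : ℝ) := by
  simp [booleanModel]

lemma measurableSet_mem_booleanModel :
    MeasurableSet {p : ((Set ℕ × (ℕ → ℝ)) × (ℕ → ℝ≥0)) × ℝ |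
      p.2 ∈ booleanModel p.1.1.1 p.1.1.2 p.1.2} := by
  simp_rw [mem_booleanModel, Set.ofPred_exists]
  refine MeasurableSet.iUnion fun i ↦ ?_
  refine MeasurableSet.inter (s₁ := {p : ((Set ℕ × (ℕ → ℝ)) × (ℕ → ℝ≥0)) × ℝ | i ∈ p.1.1.1}) ?_ ?_
  · exact (measurable_set_mem i).comp (measurable_fst.comp (measurable_fst.comp measurable_fst))
      |>.setOf
  · exact measurableSet_lt
      (f := fun p : ((Set ℕ × (ℕ → ℝ)) × (ℕ → ℝ≥0)) × ℝ ↦ dist p.2 (p.1.1.2 i))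
      (g := fun p ↦ (p.1.2 i : ℝ)) (by fun_prop) (by fun_prop)

/-- The probability that two points are both vacant, given the points carrying the radii. -/
lemma infinitePi_pair_vacant (ν : Measure ℝ≥0) [IsProbabilityMeasure ν] (I : Set ℕ) (X : ℕ → ℝ)
    (y z : ℝ) :
    Measure.infinitePi (fun _ : ℕ ↦ ν) {r | y ∉ booleanModel I X r ∧ z ∉ booleanModel I X r} =
      expNeg (∫⁻ x, negLog (1 - ν {r | x ∈ Metric.ball y (r : ℝ) ∪ Metric.ball z (r : ℝ)})
        ∂(countingMeasure I X)) := by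
  have hU : MeasurableSet {p : ℝ≥0 × ℝ | p.2 ∈ Metric.ball y (p.1 : ℝ) ∪ Metric.ball z p.1} :=
    (measurableSet_mem_ball y).union (measurableSet_mem_ball z)
  have hUx : ∀ x : ℝ, MeasurableSet {r : ℝ≥0 | x ∈ Metric.ball y (r : ℝ) ∪ Metric.ball z r} :=
    fun x ↦ measurable_prodMk_right hU
  have hm : Measurable fun x ↦ negLog
      (1 - ν {r | x ∈ Metric.ball y (r : ℝ) ∪ Metric.ball z (r : ℝ)}) :=
    measurable_negLog.comp (measurable_const.sub (measurable_measure_section hU))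
  rw [countingMeasure, lintegral_sum_measure]
  simp_rw [lintegral_dirac' _ hm, ← prob_compl_eq_one_sub (hUx _)]
  rw [← infinitePi_setOf_forall_mem ν I (fun i ↦ (hUx (X i)).compl)]
  congr 1
  ext r
  simp only [mem_booleanModel, Set.mem_ofPred_eq, Set.mem_compl_iff, Set.mem_union, not_or,
    not_exists, not_and, Metric.mem_ball, dist_comm (X _)]
  exact ⟨fun h i hi ↦ ⟨h.1 i hi, h.2 i hi⟩, fun h ↦ ⟨fun i hi ↦ (h i hi).1, fun i hi ↦ (h i hi).2⟩⟩

/-! ### Averaging over the Cox process -/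

section Cox

variable {Ω : Type*} [MeasurableSpace Ω] {P : Measure Ω} [IsProbabilityMeasure P]

/-- Disintegrate the joint law of `M` and `N` and apply the Laplace functional fibrewise. The weight
`g` allows mixed moments with functions of `M`. -/
lemma IsCoxProcess.lintegral_mul_expNeg {N M : Ω → Measure ℝ} (h : IsCoxProcess N M P)
    (hloc : ∀ᵐ m ∂(P.map M), IsLocallyFiniteMeasure m)
    {f : ℝ → ℝ≥0∞} (hf : Measurable f) {g : Measure ℝ → ℝ≥0∞} (hg : Measurable g) :
    ∫⁻ ω, g (M ω) * expNeg (∫⁻ x, f x ∂(N ω)) ∂P =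
      ∫⁻ ω, g (M ω) * expNeg (∫⁻ x, (1 - expNeg (f x)) ∂(M ω)) ∂P := by
  obtain ⟨κ, hκ, hcond, hpois⟩ := h
  have hM : AEMeasurable M P := hcond.aemeasurable_fst
  have hLf : Measurable fun η : Measure ℝ ↦ expNeg (∫⁻ x, f x ∂η) :=
    measurable_expNeg.comp (Measure.measurable_lintegral hf)
  have hLg : Measurable fun η : Measure ℝ ↦ expNeg (∫⁻ x, (1 - expNeg (f x)) ∂η) :=
    measurable_expNeg.comp (Measure.measurable_lintegral
      (measurable_const.sub (measurable_expNeg.comp hf)))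
  have hmeas : Measurable fun p : Measure ℝ × Measure ℝ ↦
      g p.1 * expNeg (∫⁻ x, f x ∂p.2) :=
    (hg.comp measurable_fst).mul (hLf.comp measurable_snd)
  have h1 := HasLaw.lintegral_comp hcond (f := fun p : Measure ℝ × Measure ℝ ↦
      g p.1 * expNeg (∫⁻ x, f x ∂p.2)) hmeas.aemeasurable
  have : SFinite (P.map M) := inferInstance
  rw [h1, Measure.lintegral_compProd hmeas,
    ← lintegral_map' (f := fun m ↦ g m * expNeg (∫⁻ x, (1 - expNeg (f x)) ∂m))
      (hg.mul hLg).aemeasurable hM]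
  refine lintegral_congr_ae ?_
  filter_upwards [hpois, hloc] with m hm hml
  rw [lintegral_const_mul _ hLf, hm.lintegral_expNeg_lintegral hf]

variable {I : Ω → Set ℕ} {X : ℕ → Ω → ℝ} {M : Ω → Measure ℝ}
  {ν : Measure ℝ≥0} [IsProbabilityMeasure ν]

lemma IsCoxProcess.lintegral_mul_pair_vacant
    (h : IsCoxProcess (fun ω ↦ countingMeasure (I ω) (fun i ↦ X i ω)) M P)
    (hloc : ∀ᵐ m ∂(P.map M), IsLocallyFiniteMeasure m)
    {g : Measure ℝ → ℝ≥0∞} (hg : Measurable g) (y z : ℝ) :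
    ∫⁻ ω, g (M ω) * Measure.infinitePi (fun _ : ℕ ↦ ν)
      {r | y ∉ booleanModel (I ω) (fun i ↦ X i ω) r ∧
        z ∉ booleanModel (I ω) (fun i ↦ X i ω) r} ∂P =
      ∫⁻ ω, g (M ω) * pairVacancy ν y z (M ω) ∂P := by
  simp_rw [infinitePi_pair_vacant]
  have hU : MeasurableSet {p : ℝ≥0 × ℝ | p.2 ∈ Metric.ball y (p.1 : ℝ) ∪ Metric.ball z p.1} :=
    (measurableSet_mem_ball y).union (measurableSet_mem_ball z)
  have hm : Measurable fun x ↦ negLog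
      (1 - ν {r | x ∈ Metric.ball y (r : ℝ) ∪ Metric.ball z (r : ℝ)}) :=
    measurable_negLog.comp (measurable_const.sub (measurable_measure_section hU))
  rw [h.lintegral_mul_expNeg hloc hm hg]
  refine lintegral_congr fun ω ↦ ?_
  -- The thinning identity: `1 - expNeg (negLog (1 - p)) = p`.
  simp_rw [expNeg_negLog tsub_le_self, ENNReal.sub_sub_cancel ENNReal.one_ne_top prob_le_one]
  rfl

end Cox

/-! ### Decay of the overlap of two balls -/

open Filter Topology

/-- The expected length, under the law `ν` of the radius, of a bound for the intersection of two
balls of the same random radius whose centres are at distance `t`, times the intensity `c`. -/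
noncomputable def overlap (ν : Measure ℝ≥0) (c : ℝ≥0) (t : ℝ) : ℝ≥0∞ :=
  c * ∫⁻ r : ℝ≥0, (if t < 2 * (r : ℝ) then 2 * (r : ℝ≥0∞) else 0) ∂ν

section Overlap

variable {ν : Measure ℝ≥0} {c : ℝ≥0}

lemma overlap_antitone : Antitone (overlap ν c) := by
  intro s t hst
  refine mul_le_mul_right (lintegral_mono fun r ↦ ?_) _
  split_ifs with h1 h2
  · exact le_rfl
  · exact absurd (hst.trans_lt h1) h2
  · exact zero_le
  · exact le_rfl

lemma overlap_ne_top (hν : ∫⁻ r, (r : ℝ≥0∞) ∂ν < ∞) (t : ℝ) : overlap ν c t ≠ ∞ := by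
  refine ENNReal.mul_ne_top ENNReal.coe_ne_top (ne_top_of_le_ne_top
    (b := ∫⁻ r : ℝ≥0, 2 * (r : ℝ≥0∞) ∂ν) ?_ (lintegral_mono fun r ↦ ?_))
  · rw [lintegral_const_mul _ (by fun_prop)]
    exact ENNReal.mul_ne_top (by simp) hν.ne
  · dsimp only
    split_ifs
    exacts [le_rfl, zero_le]

/-- Dominated convergence with dominating function `2 * r`; this is where the finite mean radius
gives decay. -/
lemma tendsto_overlap (hν : ∫⁻ r, (r : ℝ≥0∞) ∂ν < ∞) :
    Tendsto (overlap ν c) atTop (𝓝 0) := by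
  have h1 : Tendsto (fun t : ℝ ↦ ∫⁻ r : ℝ≥0,
      (if t < 2 * (r : ℝ) then 2 * (r : ℝ≥0∞) else 0) ∂ν) atTop (𝓝 (∫⁻ _, 0 ∂ν)) := by
    refine tendsto_lintegral_filter_of_dominated_convergence (fun r : ℝ≥0 ↦ 2 * (r : ℝ≥0∞))
      (Eventually.of_forall fun t ↦ ?_) (Eventually.of_forall fun t ↦ Eventually.of_forall
      fun r ↦ ?_) ?_ (Eventually.of_forall fun r ↦ ?_)
    · exact Measurable.ite (measurableSet_lt measurable_const (by fun_prop)) (by fun_prop)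
        measurable_const
    · split_ifs
      exacts [le_rfl, zero_le]
    · rw [lintegral_const_mul _ (by fun_prop)]
      exact ENNReal.mul_ne_top (by simp) hν.ne
    · refine tendsto_const_nhds.congr' ?_
      filter_upwards [eventually_ge_atTop (2 * (r : ℝ))] with t ht
      rw [if_neg (not_lt.2 ht)]
  rw [lintegral_zero] at h1
  have h2 := ENNReal.Tendsto.const_mul (a := (c : ℝ≥0∞)) h1 (Or.inr ENNReal.coe_ne_top)
  rwa [mul_zero] at h2

lemma volume_ball_inter_ball_le (y z : ℝ) (r : ℝ≥0) :
    volume (Metric.ball y (r : ℝ) ∩ Metric.ball z (r : ℝ)) ≤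
      if |y - z| < 2 * (r : ℝ) then 2 * (r : ℝ≥0∞) else 0 := by
  split_ifs with h
  · refine (measure_mono Set.inter_subset_left).trans ?_
    rw [Real.volume_ball, ENNReal.ofReal_mul (by norm_num)]
    simp
  · have : Metric.ball y (r : ℝ) ∩ Metric.ball z (r : ℝ) = ∅ := by
      ext x
      simp only [Set.mem_inter_iff, Metric.mem_ball, Real.dist_eq, Set.mem_empty_iff_false,
        iff_false, not_and]
      intro h1 h2
      apply h
      calc |y - z| = |(x - z) - (x - y)| := by ring_nf
        _ ≤ |x - z| + |x - y| := abs_sub _ _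
        _ < 2 * r := by linarith
    rw [this, measure_empty]

variable [SFinite ν] {Ω : Type*} [MeasurableSpace Ω] {M : Ω → Measure ℝ} {P : Measure Ω} [SFinite P]

lemma IsStationaryRandomMeasure.lintegral_overlap_le (h : IsStationaryRandomMeasure M P)
    (hc : ∫⁻ ω, M ω (Set.Icc 0 1) ∂P = c) (y z : ℝ) :
    ∫⁻ ω, ∫⁻ r, M ω (Metric.ball y (r : ℝ) ∩ Metric.ball z (r : ℝ)) ∂ν ∂P ≤
      overlap ν c |y - z| := by
  have hm : Measurable (Function.uncurry fun (ω : Ω) (r : ℝ≥0) ↦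
      M ω (Metric.ball y (r : ℝ) ∩ Metric.ball z (r : ℝ))) :=
    (measurable_measure_ball_inter_ball y z).comp (f := fun p : Ω × ℝ≥0 ↦ (M p.1, p.2))
      ((h.measurable.comp measurable_fst).prodMk measurable_snd)
  rw [lintegral_lintegral_swap hm.aemeasurable]
  simp_rw [fun r : ℝ≥0 ↦ h.lintegral_apply hc
    (measurableSet_ball.inter measurableSet_ball :
      MeasurableSet (Metric.ball y (r : ℝ) ∩ Metric.ball z (r : ℝ)))]
  rw [lintegral_const_mul' _ _ ENNReal.coe_ne_top]
  exact mul_le_mul_right (lintegral_mono fun r ↦ volume_ball_inter_ball_le y z r) _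

end Overlap

/-! ### Weak law of large numbers -/

/-- A weak law of large numbers for a random field on the line with decaying correlations. -/
lemma exists_seq_tendsto_ae_average {Ω : Type*} [MeasurableSpace Ω] {P : Measure Ω}
    [IsProbabilityMeasure P] {f : Ω → ℝ → ℝ} (hf : Measurable (Function.uncurry f))
    (hf1 : ∀ ω y, |f ω y| ≤ 1) {φ : ℝ → ℝ} (hφ : Antitone φ) (hφ0 : Tendsto φ atTop (𝓝 0))
    (hcov : ∀ y z, ∫ ω, f ω y * f ω z ∂P ≤ φ |y - z|) {σ : ℝ} (hσ : |σ| = 1) :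
    ∃ ns : ℕ → ℕ, StrictMono ns ∧ ∀ᵐ ω ∂P,
      Tendsto (fun k ↦ ∫ u in Set.Ioc (0 : ℝ) 1, f ω (σ * ns k * u)) atTop (𝓝 0) := by
  set μ : Measure ℝ := volume.restrict (Set.Ioc (0 : ℝ) 1)
  have hμ : IsProbabilityMeasure μ := ⟨by simp [μ]⟩
  let D : ℕ → Ω → ℝ := fun n ω ↦ ∫ u, f ω (σ * n * u) ∂μ
  have hfn : ∀ n : ℕ, Measurable fun p : Ω × ℝ ↦ f p.1 (σ * n * p.2) := fun n ↦
    hf.comp (f := fun p : Ω × ℝ ↦ (p.1, σ * n * p.2)) (by fun_prop)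
  have hDm : ∀ n, StronglyMeasurable (D n) := fun n ↦
    (hfn n).stronglyMeasurable.integral_prod_right'
  have hD1 : ∀ n ω, |D n ω| ≤ 1 := fun n ω ↦ by
    have := norm_integral_le_of_norm_le_const (μ := μ) (f := fun u ↦ f ω (σ * n * u)) (C := 1)
      (Eventually.of_forall fun u ↦ hf1 _ _)
    simpa using this
  have hφnn : ∀ t, 0 ≤ φ t := fun t ↦ hφ.le_of_tendsto hφ0 t
  have hφb : ∀ (n : ℕ) (p : ℝ × ℝ), ‖φ (n * |p.1 - p.2|)‖ ≤ φ 0 := fun n p ↦ by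
    rw [Real.norm_of_nonneg (hφnn _)]
    exact hφ (by positivity)
  have hφint : ∀ n : ℕ, Integrable (fun p : ℝ × ℝ ↦ φ (n * |p.1 - p.2|)) (μ.prod μ) := fun n ↦
    Integrable.of_bound (hφ.measurable.comp (f := fun p : ℝ × ℝ ↦ (n : ℝ) * |p.1 - p.2|)
      (by fun_prop)).aestronglyMeasurable (φ 0) (Eventually.of_forall (hφb n))
  -- The squared average is a double integral over the unit square, so Fubini brings in the
  -- covariance bound.
  have hbound : ∀ n : ℕ, ∫ ω, D n ω ^ 2 ∂P ≤ ∫ p : ℝ × ℝ, φ (n * |p.1 - p.2|) ∂(μ.prod μ) := by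
    intro n
    have h1 : ∀ ω, D n ω ^ 2 = ∫ p : ℝ × ℝ, f ω (σ * n * p.1) * f ω (σ * n * p.2) ∂(μ.prod μ) :=
      fun ω ↦ by rw [sq, integral_prod_mul (fun u ↦ f ω (σ * n * u)) (fun u ↦ f ω (σ * n * u))]
    simp_rw [h1]
    have hmeas : Measurable fun q : Ω × ℝ × ℝ ↦ f q.1 (σ * n * q.2.1) * f q.1 (σ * n * q.2.2) :=
      ((hfn n).comp (f := fun q : Ω × ℝ × ℝ ↦ (q.1, q.2.1)) (by fun_prop)).mul
        ((hfn n).comp (f := fun q : Ω × ℝ × ℝ ↦ (q.1, q.2.2)) (by fun_prop))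
    have hint : Integrable (fun q : Ω × ℝ × ℝ ↦ f q.1 (σ * n * q.2.1) * f q.1 (σ * n * q.2.2))
        (P.prod (μ.prod μ)) :=
      Integrable.of_bound hmeas.aestronglyMeasurable 1 (Eventually.of_forall fun q ↦ by
        rw [norm_mul]
        exact mul_le_one₀ (hf1 _ _) (norm_nonneg _) (hf1 _ _))
    rw [integral_integral_swap hint]
    refine integral_mono hint.swap.integral_prod_left (hφint n) fun p ↦ ?_
    refine (hcov _ _).trans (le_of_eq ?_)
    rw [show σ * n * p.1 - σ * n * p.2 = σ * (n * (p.1 - p.2)) by ring, abs_mul, hσ, one_mul,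
      abs_mul, Nat.abs_cast]
  -- Off the diagonal `n * |p.1 - p.2|` tends to infinity, so the integrand tends to `0` there.
  have hdiag : ∀ᵐ p : ℝ × ℝ ∂(μ.prod μ), p.1 ≠ p.2 := by
    have hs : MeasurableSet {p : ℝ × ℝ | p.1 = p.2} :=
      measurableSet_eq_fun measurable_fst measurable_snd
    rw [ae_iff]
    simp only [ne_eq, not_not]
    rw [Measure.measure_prod_null hs]
    refine Eventually.of_forall fun x ↦ ?_
    have : Prod.mk x ⁻¹' {p : ℝ × ℝ | p.1 = p.2} = {x} := by
      ext y
      simp [eq_comm]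
    simp [this]
  have hφlim : Tendsto (fun n : ℕ ↦ ∫ p : ℝ × ℝ, φ (n * |p.1 - p.2|) ∂(μ.prod μ)) atTop (𝓝 0) := by
    rw [← integral_zero (ℝ × ℝ) ℝ (μ := μ.prod μ)]
    refine tendsto_integral_of_dominated_convergence (fun _ ↦ φ 0)
      (fun n ↦ (hφint n).aestronglyMeasurable) (integrable_const _)
      (fun n ↦ Eventually.of_forall fun p ↦ hφb n p) ?_
    filter_upwards [hdiag] with p hp
    exact hφ0.comp (tendsto_natCast_atTop_atTop.atTop_mul_const (abs_pos.2 (sub_ne_zero.2 hp)))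
  have hlim : Tendsto (fun n ↦ ∫ ω, D n ω ^ 2 ∂P) atTop (𝓝 0) :=
    squeeze_zero (fun n ↦ integral_nonneg fun ω ↦ sq_nonneg _) hbound hφlim
  have hmeas : TendstoInMeasure P (fun n ω ↦ D n ω ^ 2) atTop (fun _ ↦ 0) := by
    refine tendstoInMeasure_of_tendsto_eLpNorm one_ne_zero
      (fun n ↦ ((hDm n).pow 2).aestronglyMeasurable) aestronglyMeasurable_const ?_
    have h1 : ∀ n, eLpNorm ((fun ω ↦ D n ω ^ 2) - fun _ ↦ (0 : ℝ)) 1 P =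
        ENNReal.ofReal (∫ ω, D n ω ^ 2 ∂P) := by
      intro n
      rw [eLpNorm_one_eq_lintegral_enorm, ← ofReal_integral_norm_eq_lintegral_enorm]
      · simp
      · exact Integrable.of_bound (((hDm n).pow 2).aestronglyMeasurable.sub
          aestronglyMeasurable_const) 1 (Eventually.of_forall fun ω ↦ by
            simpa using hD1 n ω)
    simp_rw [h1]
    simpa [Function.comp_def] using (ENNReal.continuous_ofReal.tendsto _).comp hlim
  obtain ⟨ns, hns, hae⟩ := hmeas.exists_seq_tendsto_ae
  refine ⟨ns, hns, hae.mono fun ω hω ↦ ?_⟩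
  have := (Real.continuous_sqrt.tendsto _).comp hω
  simp only [Function.comp_def, Real.sqrt_zero, Real.sqrt_sq_eq_abs] at this
  exact tendsto_zero_iff_abs_tendsto_zero _ |>.2 this

/-! ### Covariances of the vacant set -/

/-- The indicator function of the vacant set of a Boolean model. -/
noncomputable def vacant (p : (Set ℕ × (ℕ → ℝ)) × (ℕ → ℝ≥0)) (y : ℝ) : ℝ :=
  (booleanModel p.1.1 p.1.2 p.2)ᶜ.indicator 1 y

lemma measurable_vacant : Measurable (Function.uncurry vacant) := by
  have : Function.uncurry vacant =
      {p : ((Set ℕ × (ℕ → ℝ)) × (ℕ → ℝ≥0)) × ℝ |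
        p.2 ∈ booleanModel p.1.1.1 p.1.1.2 p.1.2}ᶜ.indicator 1 := by
    ext p
    rfl
  rw [this]
  exact measurable_one.indicator measurableSet_mem_booleanModel.compl

lemma vacant_eq_zero_or_one (p : (Set ℕ × (ℕ → ℝ)) × (ℕ → ℝ≥0)) (y : ℝ) :
    vacant p y = 0 ∨ vacant p y = 1 :=
  Set.indicator_eq_zero_or_self _ _ _

lemma abs_toReal_vacancy_le (ν : Measure ℝ≥0) (y : ℝ) (m : Measure ℝ) :
    |(vacancy ν y m).toReal| ≤ 1 := by
  rw [abs_of_nonneg ENNReal.toReal_nonneg]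
  exact ENNReal.toReal_le_of_le_ofReal zero_le_one (by simpa using vacancy_le_one ν y m)

lemma integral_sub_mul_sub {Ω : Type*} [MeasurableSpace Ω] {P : Measure Ω} [IsProbabilityMeasure P]
    {a b q r : Ω → ℝ} (ha : Measurable a) (hb : Measurable b) (hq : Measurable q)
    (hr : Measurable r) (ha1 : ∀ ω, ‖a ω‖ ≤ 1) (hb1 : ∀ ω, ‖b ω‖ ≤ 1) (hq1 : ∀ ω, ‖q ω‖ ≤ 1)
    (hr1 : ∀ ω, ‖r ω‖ ≤ 1) :
    ∫ ω, (a ω - q ω) * (b ω - r ω) ∂P = ∫ ω, a ω * b ω ∂P - ∫ ω, r ω * a ω ∂P -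
      ∫ ω, q ω * b ω ∂P + ∫ ω, q ω * r ω ∂P := by
  have hint : ∀ {f g : Ω → ℝ}, Measurable f → Measurable g → (∀ ω, ‖f ω‖ ≤ 1) →
      (∀ ω, ‖g ω‖ ≤ 1) → Integrable (fun ω ↦ f ω * g ω) P := fun hf hg hf1 hg1 ↦
    Integrable.of_bound (hf.mul hg).aestronglyMeasurable 1 (Eventually.of_forall fun ω ↦ by
      rw [norm_mul]
      exact mul_le_one₀ (hf1 ω) (norm_nonneg _) (hg1 ω))
  have i1 := hint ha hb ha1 hb1
  have i2 := hint hr ha hr1 ha1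
  have i3 := hint hq hb hq1 hb1
  have i4 := hint hq hr hq1 hr1
  have i5 : Integrable (fun ω ↦ a ω * b ω - r ω * a ω) P := i1.sub i2
  have i6 : Integrable (fun ω ↦ a ω * b ω - r ω * a ω - q ω * b ω) P := i5.sub i3
  rw [← integral_sub i1 i2, ← integral_sub i5 i3, ← integral_add i6 i4]
  exact integral_congr_ae (Eventually.of_forall fun ω ↦ by ring)

/-- The marked point configuration attached to an outcome of the points and the radii. -/
def markedPoints {Ω : Type*} (I : Ω → Set ℕ) (X : ℕ → Ω → ℝ) (p : Ω × (ℕ → ℝ≥0)) :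
    (Set ℕ × (ℕ → ℝ)) × (ℕ → ℝ≥0) :=
  ((I p.1, fun i ↦ X i p.1), p.2)

lemma measurable_markedPoints {Ω : Type*} [MeasurableSpace Ω] {I : Ω → Set ℕ} {X : ℕ → Ω → ℝ}
    (hI : Measurable I) (hX : ∀ i, Measurable (X i)) : Measurable (markedPoints I X) :=
  ((hI.prodMk (measurable_pi_lambda _ hX)).comp measurable_fst).prodMk measurable_snd

section Cox

variable {Ω : Type*} [MeasurableSpace Ω] {P : Measure Ω} [IsProbabilityMeasure P]
  {I : Ω → Set ℕ} {X : ℕ → Ω → ℝ} {M : Ω → Measure ℝ} {ν : Measure ℝ≥0} [IsProbabilityMeasure ν]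

/-- The second factor of the product space is a fresh i.i.d. sample of radii. Integrating it out
first reduces the claim to `IsCoxProcess.lintegral_mul_pair_vacant`. -/
lemma IsCoxProcess.integral_mul_vacant_mul_vacant
    (h : IsCoxProcess (fun ω ↦ countingMeasure (I ω) (fun i ↦ X i ω)) M P)
    (hI : Measurable I) (hX : ∀ i, Measurable (X i)) (hM : Measurable M)
    (hloc : ∀ᵐ m ∂(P.map M), IsLocallyFiniteMeasure m)
    {g : Measure ℝ → ℝ≥0∞} (hg : Measurable g) (hg1 : ∀ m, g m ≤ 1) (y z : ℝ) :
    ∫ p, (g (M p.1)).toReal * (vacant (markedPoints I X p) y *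
      vacant (markedPoints I X p) z)
      ∂(P.prod (Measure.infinitePi fun _ : ℕ ↦ ν)) =
    (∫⁻ ω, g (M ω) * pairVacancy ν y z (M ω) ∂P).toReal := by
  set π := Measure.infinitePi fun _ : ℕ ↦ ν
  let e : Ω × (ℕ → ℝ≥0) → (Set ℕ × (ℕ → ℝ)) × (ℕ → ℝ≥0) := fun p ↦
    markedPoints I X p
  have he : Measurable e := measurable_markedPoints hI hX
  let S : Set (Ω × (ℕ → ℝ≥0)) := {p | y ∉ booleanModel (I p.1) (fun i ↦ X i p.1) p.2 ∧
    z ∉ booleanModel (I p.1) (fun i ↦ X i p.1) p.2}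
  have hS : MeasurableSet S :=
    ((measurableSet_mem_booleanModel.compl).preimage
      (he.prodMk (measurable_const : Measurable fun _ ↦ y))).inter
    ((measurableSet_mem_booleanModel.compl).preimage
      (he.prodMk (measurable_const : Measurable fun _ ↦ z)))
  have hgS : Measurable fun p : Ω × (ℕ → ℝ≥0) ↦ g (M p.1) * S.indicator 1 p :=
    (hg.comp (hM.comp measurable_fst)).mul (measurable_one.indicator hS)
  have h1 : ∀ p : Ω × (ℕ → ℝ≥0), (g (M p.1)).toReal *
      (vacant (markedPoints I X p) y * vacant (markedPoints I X p) z) =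
      (g (M p.1) * S.indicator 1 p).toReal := by
    intro p
    rw [ENNReal.toReal_mul]
    congr 1
    by_cases hy : y ∈ booleanModel (I p.1) (fun i ↦ X i p.1) p.2 <;>
    by_cases hz : z ∈ booleanModel (I p.1) (fun i ↦ X i p.1) p.2 <;>
    simp [vacant, markedPoints, S, hy, hz]
  simp_rw [h1]
  rw [integral_toReal hgS.aemeasurable (Eventually.of_forall fun p ↦ ?_),
    lintegral_prod _ hgS.aemeasurable, ← h.lintegral_mul_pair_vacant (ν := ν) hloc hg y z]
  · congr 1
    refine lintegral_congr fun ω ↦ ?_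
    have hSω : MeasurableSet (Prod.mk ω ⁻¹' S) := measurable_prodMk_left hS
    change ∫⁻ r, g (M ω) * S.indicator 1 (ω, r) ∂π = _
    rw [lintegral_const_mul' _ _ ((hg1 _).trans_lt ENNReal.one_lt_top).ne]
    congr 1
    exact lintegral_indicator_one hSω
  · refine ENNReal.mul_lt_top ((hg1 _).trans_lt ENNReal.one_lt_top) ?_
    by_cases hp : p ∈ S <;> simp [hp]

/-- The covariances of the fluctuations of the vacant set around its conditional mean. -/
lemma IsCoxProcess.integral_vacant_sub_mul_le
    (h : IsCoxProcess (fun ω ↦ countingMeasure (I ω) (fun i ↦ X i ω)) M P)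
    (hI : Measurable I) (hX : ∀ i, Measurable (X i)) (hM : IsStationaryRandomMeasure M P)
    {c : ℝ≥0} (hc : ∫⁻ ω, M ω (Set.Icc 0 1) ∂P = c) (hν : ∫⁻ r, (r : ℝ≥0∞) ∂ν < ∞) (y z : ℝ) :
    ∫ p, (vacant (markedPoints I X p) y - (vacancy ν y (M p.1)).toReal) *
      (vacant (markedPoints I X p) z - (vacancy ν z (M p.1)).toReal)
      ∂(P.prod (Measure.infinitePi fun _ : ℕ ↦ ν)) ≤ (overlap ν c |y - z|).toReal := by
  set π := Measure.infinitePi fun _ : ℕ ↦ ν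
  have hloc := hM.ae_map_isLocallyFiniteMeasure hc
  have hlocω : ∀ᵐ ω ∂P, IsLocallyFiniteMeasure (M ω) :=
    ae_of_ae_map hM.measurable.aemeasurable hloc
  let a : ℝ → Ω × (ℕ → ℝ≥0) → ℝ := fun y p ↦ vacant (markedPoints I X p) y
  let q : ℝ → Ω × (ℕ → ℝ≥0) → ℝ := fun y p ↦ (vacancy ν y (M p.1)).toReal
  have hqm : ∀ y, Measurable fun m ↦ vacancy ν y m := fun y ↦
    (measurable_vacancy ν).comp (f := fun m : Measure ℝ ↦ (m, y)) (by fun_prop)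
  have ha_meas : ∀ y, Measurable (a y) := fun y ↦
    measurable_vacant.comp (f := fun p ↦ (markedPoints I X p, y))
      ((measurable_markedPoints hI hX).prodMk measurable_const)
  have hq_meas : ∀ y, Measurable (q y) := fun y ↦
    ((hqm y).comp (hM.measurable.comp measurable_fst)).ennreal_toReal
  have ha1 : ∀ y p, ‖a y p‖ ≤ 1 := fun y p ↦ by
    rcases vacant_eq_zero_or_one (markedPoints I X p) y with h | h <;> simp [a, h]
  have hq1 : ∀ y p, ‖q y p‖ ≤ 1 := fun y p ↦ abs_toReal_vacancy_le ν y _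
  set A := ∫⁻ ω, vacancy ν y (M ω) * vacancy ν z (M ω) ∂P
  have hA : A ≤ 1 := by
    calc A ≤ ∫⁻ ω, 1 ∂P := lintegral_mono fun ω ↦
          mul_le_one' (vacancy_le_one ν y _) (vacancy_le_one ν z _)
      _ = 1 := by simp
  have hself : ∀ y p, a y p * a y p = a y p := fun y p ↦ by
    rcases vacant_eq_zero_or_one (markedPoints I X p) y with h | h <;> simp [a, h]
  -- An indicator equals its square, so the pair formula with equal points yields the one-point
  -- mixed moment.
  have hqa : ∀ y z, ∫ p, q y p * a z p ∂(P.prod π) =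
      (∫⁻ ω, vacancy ν y (M ω) * vacancy ν z (M ω) ∂P).toReal := by
    intro y z
    have := h.integral_mul_vacant_mul_vacant (ν := ν) hI hX hM.measurable hloc
      (hqm y) (vacancy_le_one ν y) z z
    simp only [a, q] at hself ⊢
    simp_rw [hself] at this
    rw [this]
    congr 1
    refine lintegral_congr_ae (hlocω.mono fun ω hω ↦ ?_)
    simp only [pairVacancy_self]
  have hqq : ∫ p, q y p * q z p ∂(P.prod π) = A.toReal := by
    have h1 : ∀ p : Ω × (ℕ → ℝ≥0), q y p * q z p =
        (vacancy ν y (M p.1) * vacancy ν z (M p.1)).toReal := fun p ↦ ENNReal.toReal_mul.symm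
    have hm : Measurable fun p : Ω × (ℕ → ℝ≥0) ↦ vacancy ν y (M p.1) * vacancy ν z (M p.1) :=
      ((hqm y).mul (hqm z)).comp (hM.measurable.comp measurable_fst)
    simp_rw [h1]
    rw [integral_toReal hm.aemeasurable (Eventually.of_forall fun p ↦
      (mul_le_one' (vacancy_le_one ν y _) (vacancy_le_one ν z _)).trans_lt ENNReal.one_lt_top),
      lintegral_prod _ hm.aemeasurable]
    simp [A]
  have haa : ∫ p, a y p * a z p ∂(P.prod π) = (∫⁻ ω, pairVacancy ν y z (M ω) ∂P).toReal := by
    simpa using h.integral_mul_vacant_mul_vacant (ν := ν) hI hX hM.measurable hloc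
      (g := fun _ ↦ 1) measurable_const (fun _ ↦ le_rfl) y z
  have hle : (∫⁻ ω, pairVacancy ν y z (M ω) ∂P).toReal ≤
      A.toReal + (overlap ν c |y - z|).toReal := by
    rw [← ENNReal.toReal_add (ne_top_of_le_ne_top ENNReal.one_ne_top hA) (overlap_ne_top hν _)]
    refine ENNReal.toReal_mono (ENNReal.add_ne_top.2
      ⟨ne_top_of_le_ne_top ENNReal.one_ne_top hA, overlap_ne_top hν _⟩) ?_
    calc ∫⁻ ω, pairVacancy ν y z (M ω) ∂P
        ≤ ∫⁻ ω, (vacancy ν y (M ω) * vacancy ν z (M ω) +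
          ∫⁻ r, M ω (Metric.ball y (r : ℝ) ∩ Metric.ball z (r : ℝ)) ∂ν) ∂P :=
          lintegral_mono_ae (hlocω.mono fun ω hω ↦ pairVacancy_le y z _)
      _ = A + ∫⁻ ω, ∫⁻ r, M ω (Metric.ball y (r : ℝ) ∩ Metric.ball z (r : ℝ)) ∂ν ∂P :=
          lintegral_add_left (((hqm y).mul (hqm z)).comp hM.measurable) _
      _ ≤ A + overlap ν c |y - z| := by
          gcongr
          exact hM.lintegral_overlap_le hc y z
  have hsub := integral_sub_mul_sub (P := P.prod π) (ha_meas y) (ha_meas z) (hq_meas y) (hq_meas z)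
    (ha1 y) (ha1 z) (hq1 y) (hq1 z)
  refine hsub.le.trans ?_
  -- Both cross terms and the last term equal `A`, leaving the pair moment minus `A`.
  rw [hqa, hqa, hqq, haa]
  have hcomm : ∫⁻ ω, vacancy ν z (M ω) * vacancy ν y (M ω) ∂P = A :=
    lintegral_congr fun ω ↦ mul_comm _ _
  rw [hcomm]
  linarith

end Cox

/-! ### Mean vacancy and ergodicity -/

/-- The shifted and the original window differ by two end pieces of length `|t|`. -/
lemma abs_integral_comp_sub_sub_integral_le {g : ℝ → ℝ} (hg : Measurable g)
    (hg1 : ∀ y, |g y| ≤ 1) (t : ℝ) :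
    |(∫ u in Set.Ioc (0 : ℝ) 1, g (u - t)) - ∫ u in Set.Ioc (0 : ℝ) 1, g u| ≤ 2 * |t| := by
  have hint : ∀ a b, IntervalIntegrable g volume a b := fun a b ↦
    intervalIntegrable_const (c := (1 : ℝ)) |>.mono_fun hg.aestronglyMeasurable
      (Eventually.of_forall fun y ↦ by simpa using hg1 y)
  rw [← intervalIntegral.integral_of_le zero_le_one, ← intervalIntegral.integral_of_le zero_le_one,
    intervalIntegral.integral_comp_sub_right, intervalIntegral.integral_interval_sub_interval_comm
      (hint _ _) (hint _ _) (hint _ _)]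
  have hb : ∀ a b, |∫ u in a..b, g u| ≤ |b - a| := fun a b ↦ by
    simpa using intervalIntegral.norm_integral_le_of_norm_le_const (a := a) (b := b) (C := 1)
      (f := g) (fun y _ ↦ hg1 y)
  calc |(∫ u in (0 - t)..0, g u) - ∫ u in (1 - t)..1, g u|
      ≤ |∫ u in (0 - t)..0, g u| + |∫ u in (1 - t)..1, g u| := abs_sub _ _
    _ ≤ |0 - (0 - t)| + |1 - (1 - t)| := add_le_add (hb _ _) (hb _ _)
    _ = 2 * |t| := by ring_nf

/-- The average of the vacancy probabilities over the interval between `0` and `σ * n`. -/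
noncomputable def meanVacancy (ν : Measure ℝ≥0) (σ : ℝ) (n : ℕ) (m : Measure ℝ) : ℝ :=
  ∫ u in Set.Ioc (0 : ℝ) 1, (vacancy ν (σ * n * u) m).toReal

lemma abs_meanVacancy_le (ν : Measure ℝ≥0) (σ : ℝ) (n : ℕ) (m : Measure ℝ) : |meanVacancy ν σ n m| ≤ 1 := by
  simpa [meanVacancy] using norm_integral_le_of_norm_le_const
    (μ := volume.restrict (Set.Ioc (0 : ℝ) 1)) (f := fun u ↦ (vacancy ν (σ * n * u) m).toReal)
    (C := 1) (Eventually.of_forall fun u ↦ abs_toReal_vacancy_le ν _ m)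

section MeanVacancy

variable {ν : Measure ℝ≥0} [SFinite ν] {σ : ℝ}

lemma measurable_vacancy_mul (n : ℕ) :
    Measurable fun p : Measure ℝ × ℝ ↦ (vacancy ν (σ * n * p.2) p.1).toReal :=
  ((measurable_vacancy ν).comp (f := fun p : Measure ℝ × ℝ ↦ (p.1, σ * n * p.2))
    (by fun_prop)).ennreal_toReal

lemma measurable_vacancy_toReal (m : Measure ℝ) :
    Measurable fun y : ℝ ↦ (vacancy ν y m).toReal :=
  ((measurable_vacancy ν).comp (f := fun y : ℝ ↦ (m, y)) (by fun_prop)).ennreal_toReal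

lemma measurable_meanVacancy (n : ℕ) : Measurable (meanVacancy ν σ n) :=
  ((measurable_vacancy_mul n).stronglyMeasurable.integral_prod_right').measurable

lemma abs_meanVacancy_translateMeasure_sub_le (hσ : |σ| = 1) {n : ℕ} (hn : n ≠ 0) (x : ℝ)
    (m : Measure ℝ) :
    |meanVacancy ν σ n (translateMeasure x m) - meanVacancy ν σ n m| ≤ 2 * |x| / n := by
  have hn' : (n : ℝ) ≠ 0 := by exact_mod_cast hn
  have hσ0 : σ ≠ 0 := by rintro rfl; simp at hσ
  have h := abs_integral_comp_sub_sub_integral_le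
    (g := fun u ↦ (vacancy ν (σ * n * u) m).toReal)
    ((measurable_vacancy_toReal m).comp (measurable_const_mul (σ * n)))
    (fun y ↦ abs_toReal_vacancy_le ν _ m) (x / (σ * n))
  rw [abs_div, abs_mul, hσ, one_mul, Nat.abs_cast, ← mul_div_assoc] at h
  have h1 : ∀ u : ℝ, σ * n * (u - x / (σ * n)) = σ * n * u - x := fun u ↦ by field_simp
  simp_rw [h1] at h
  simpa only [meanVacancy, vacancy_translateMeasure] using h

lemma tendsto_meanVacancy_translateMeasure_iff (hσ : |σ| = 1) {ns : ℕ → ℕ} (hns : StrictMono ns)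
    (x : ℝ) (m : Measure ℝ) :
    Tendsto (fun k ↦ meanVacancy ν σ (ns k) (translateMeasure x m)) atTop (𝓝 0) ↔
      Tendsto (fun k ↦ meanVacancy ν σ (ns k) m) atTop (𝓝 0) := by
  have h0 : Tendsto (fun k ↦ meanVacancy ν σ (ns k) (translateMeasure x m) -
      meanVacancy ν σ (ns k) m) atTop (𝓝 0) := by
    rw [tendsto_zero_iff_abs_tendsto_zero]
    refine squeeze_zero' (Eventually.of_forall fun k ↦ abs_nonneg _) ?_
      ((tendsto_const_nhds (x := 2 * |x|)).div_atTop
        (tendsto_natCast_atTop_atTop.comp hns.tendsto_atTop))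
    filter_upwards [eventually_gt_atTop 0] with k hk
    exact abs_meanVacancy_translateMeasure_sub_le hσ
      ((Nat.zero_le _).trans_lt (hns hk)).ne' x m
  constructor
  · intro h
    simpa using h.sub h0
  · intro h
    simpa using h.add h0

variable {Ω : Type*} [MeasurableSpace Ω] {P : Measure Ω} {M : Ω → Measure ℝ}

lemma IsStationaryRandomMeasure.integral_vacancy (hM : IsStationaryRandomMeasure M P) (y : ℝ) :
    ∫ ω, (vacancy ν y (M ω)).toReal ∂P = ∫ ω, (vacancy ν 0 (M ω)).toReal ∂P := by
  have hm : ∀ z, Measurable fun m : Measure ℝ ↦ (vacancy ν z m).toReal := fun z ↦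
    ((measurable_vacancy ν).comp (f := fun m : Measure ℝ ↦ (m, z)) (by fun_prop)).ennreal_toReal
  have h1 : ∀ ω, vacancy ν y (M ω) = vacancy ν 0 (translateMeasure (-y) (M ω)) := fun ω ↦ by
    rw [vacancy_translateMeasure]
    congr 1
    ring
  simp_rw [h1]
  rw [← integral_map (φ := fun ω ↦ translateMeasure (-y) (M ω))
    (f := fun m ↦ (vacancy ν 0 m).toReal)
    ((measurable_translateMeasure _).comp hM.measurable).aemeasurable
    (hm 0).aestronglyMeasurable, hM.map_translate,
    integral_map hM.measurable.aemeasurable (hm 0).aestronglyMeasurable]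

variable [IsProbabilityMeasure P]

lemma IsStationaryRandomMeasure.integral_vacancy_pos (hM : IsStationaryRandomMeasure M P)
    {c : ℝ≥0} (hc : ∫⁻ ω, M ω (Set.Icc 0 1) ∂P = c) (hν : ∫⁻ r, (r : ℝ≥0∞) ∂ν < ∞) :
    0 < ∫ ω, (vacancy ν 0 (M ω)).toReal ∂P := by
  have hm : Measurable fun ω ↦ (vacancy ν 0 (M ω)).toReal :=
    ((measurable_vacancy ν).comp (f := fun ω ↦ (M ω, (0 : ℝ)))
      (hM.measurable.prodMk measurable_const)).ennreal_toReal
  have hfin : ∀ᵐ ω ∂P, ∫⁻ r, M ω (Metric.ball 0 (r : ℝ)) ∂ν < ∞ := by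
    refine ae_lt_top ?_ ?_
    · exact Measurable.lintegral_prod_right' (f := fun p : Ω × ℝ≥0 ↦ M p.1 (Metric.ball 0 (p.2 : ℝ)))
        (measurable_measure_ball.comp (f := fun p : Ω × ℝ≥0 ↦ ((M p.1, (0 : ℝ)), p.2))
          (((hM.measurable.comp measurable_fst).prodMk measurable_const).prodMk measurable_snd))
    · have h1 := hM.lintegral_overlap_le (ν := ν) hc 0 0
      simp only [Set.inter_self] at h1
      exact ne_top_of_le_ne_top (overlap_ne_top hν _) h1
  have hpos : ∀ᵐ ω ∂P, 0 < (vacancy ν 0 (M ω)).toReal := hfin.mono fun ω hω ↦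
    ENNReal.toReal_pos (fun h ↦ hω.ne (expNeg_eq_zero_iff.1 h)) (expNeg_ne_top _)
  rw [integral_pos_iff_support_of_nonneg_ae (hpos.mono fun ω hω ↦ hω.le)
    (Integrable.of_bound hm.aestronglyMeasurable 1
      (Eventually.of_forall fun ω ↦ abs_toReal_vacancy_le ν _ _))]
  have : P (Function.support fun ω ↦ (vacancy ν 0 (M ω)).toReal) = 1 :=
    (prob_compl_eq_zero_iff (measurableSet_support hm)).1 
      (hpos.mono fun ω hω ↦ hω.ne')
  simp [this]

/-- If the invariant event had probability `1`, bounded convergence would send the expectations to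
`0`; by stationarity they all equal the same positive number. -/
lemma IsErgodicRandomMeasure.ae_not_tendsto_meanVacancy (hM : IsErgodicRandomMeasure M P)
    {c : ℝ≥0} (hc : ∫⁻ ω, M ω (Set.Icc 0 1) ∂P = c) (hν : ∫⁻ r, (r : ℝ≥0∞) ∂ν < ∞)
    (hσ : |σ| = 1) {ns : ℕ → ℕ} (hns : StrictMono ns) :
    ∀ᵐ ω ∂P, ¬ Tendsto (fun k ↦ meanVacancy ν σ (ns k) (M ω)) atTop (𝓝 0) := by
  have hE : MeasurableSet {m : Measure ℝ |
      Tendsto (fun k ↦ meanVacancy ν σ (ns k) m) atTop (𝓝 0)} :=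
    measurableSet_tendsto _ fun k ↦ measurable_meanVacancy (ns k)
  rcases hM.zero_or_one _ hE fun x ↦
    Set.ext fun m ↦ tendsto_meanVacancy_translateMeasure_iff hσ hns x m with h | h
  · rw [ae_iff]
    simp only [not_not]
    exact h
  exfalso
  have hae : ∀ᵐ ω ∂P, Tendsto (fun k ↦ meanVacancy ν σ (ns k) (M ω)) atTop (𝓝 0) :=
    (prob_compl_eq_zero_iff (hM.measurable hE)).2 h
  have h1 : Tendsto (fun k ↦ ∫ ω, meanVacancy ν σ (ns k) (M ω) ∂P) atTop (𝓝 (∫ _, 0 ∂P)) :=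
    tendsto_integral_of_dominated_convergence (fun _ ↦ 1)
      (fun k ↦ ((measurable_meanVacancy _).comp hM.measurable).aestronglyMeasurable)
      (integrable_const _) (fun k ↦ Eventually.of_forall fun ω ↦ abs_meanVacancy_le _ _ _ _) hae
  have h2 : ∀ n : ℕ, ∫ ω, meanVacancy ν σ n (M ω) ∂P = ∫ ω, (vacancy ν 0 (M ω)).toReal ∂P := by
    intro n
    have hf : Measurable fun p : Ω × ℝ ↦ (vacancy ν (σ * n * p.2) (M p.1)).toReal :=
      (measurable_vacancy_mul n).comp (f := fun p : Ω × ℝ ↦ (M p.1, p.2))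
        ((hM.measurable.comp measurable_fst).prodMk measurable_snd)
    simp only [meanVacancy]
    rw [integral_integral_swap (f := fun ω u ↦ (vacancy ν (σ * n * u) (M ω)).toReal)
      (Integrable.of_bound hf.aestronglyMeasurable 1
        (Eventually.of_forall fun p ↦ abs_toReal_vacancy_le ν _ _))]
    simp [hM.integral_vacancy]
  simp_rw [h2, integral_zero] at h1
  exact (hM.integral_vacancy_pos hc hν).ne' (tendsto_nhds_unique tendsto_const_nhds h1)

end MeanVacancy

/-! ### Excluding covered half-lines -/

lemma tendsto_average_vacant_of_halfLine_subset {p : (Set ℕ × (ℕ → ℝ)) × (ℕ → ℝ≥0)} {σ a : ℝ}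
    (hσ : |σ| = 1) (h : ∀ y, a ≤ σ * y → y ∈ booleanModel p.1.1 p.1.2 p.2) {ns : ℕ → ℕ}
    (hns : StrictMono ns) :
    Tendsto (fun k ↦ ∫ u in Set.Ioc (0 : ℝ) 1, vacant p (σ * ns k * u)) atTop (𝓝 0) := by
  have hσ2 : σ * σ = 1 := by rw [← sq, ← sq_abs, hσ, one_pow]
  suffices Tendsto (fun k ↦ ∫ u in Set.Ioc (0 : ℝ) 1, vacant p (σ * ns k * u)) atTop
      (𝓝 (∫ _ in Set.Ioc (0 : ℝ) 1, (0 : ℝ))) by simpa using this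
  refine tendsto_integral_of_dominated_convergence (fun _ ↦ 1) (fun k ↦ ?_) (integrable_const _)
    (fun k ↦ Eventually.of_forall fun u ↦ ?_) ?_
  · exact (measurable_vacant.comp (f := fun u : ℝ ↦ (p, σ * ns k * u))
      (by fun_prop)).aestronglyMeasurable
  · rcases vacant_eq_zero_or_one p (σ * ns k * u) with h | h <;> simp [h]
  · filter_upwards [ae_restrict_mem measurableSet_Ioc] with u hu
    refine tendsto_const_nhds.congr' ?_
    have hlim : Tendsto (fun k ↦ (ns k : ℝ) * u) atTop atTop :=
      (tendsto_natCast_atTop_atTop.comp hns.tendsto_atTop).atTop_mul_const hu.1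
    filter_upwards [hlim.eventually_ge_atTop a] with k hk
    have : σ * ns k * u ∈ booleanModel p.1.1 p.1.2 p.2 := h _ (by
      rwa [mul_assoc, ← mul_assoc, hσ2, one_mul])
    simp [vacant, this]

/-- A connected subset of the line is order-convex, so a component unbounded in one direction
contains everything beyond `x` in that direction. -/
lemma HasUnboundedComponent.exists_halfLine_subset {C : Set ℝ} (h : HasUnboundedComponent C) :
    ∃ a : ℝ, (∀ y, a ≤ 1 * y → y ∈ C) ∨ ∀ y, a ≤ -1 * y → y ∈ C := by
  obtain ⟨x, hx, hunb⟩ := h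
  have hsub := connectedComponentIn_subset C x
  have hord := (isPreconnected_connectedComponentIn (F := C) (x := x)).ordConnected
  have hxc := mem_connectedComponentIn hx
  rw [isBounded_iff_bddBelow_bddAbove, not_and_or] at hunb
  rcases hunb with hb | hb
  · refine ⟨-x, Or.inr fun y hy ↦ hsub ?_⟩
    obtain ⟨z, hz, hzy⟩ := not_bddBelow_iff.1 hb y
    exact hord.out hz hxc ⟨hzy.le, by linarith⟩
  · refine ⟨x, Or.inl fun y hy ↦ hsub ?_⟩
    obtain ⟨z, hz, hzy⟩ := not_bddAbove_iff.1 hb y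
    exact hord.out hxc hz ⟨by linarith, hzy.le⟩

section Cox

variable {Ω : Type*} [MeasurableSpace Ω] {P : Measure Ω} [IsProbabilityMeasure P]
  {I : Ω → Set ℕ} {X : ℕ → Ω → ℝ} {M : Ω → Measure ℝ} {ν : Measure ℝ≥0} [IsProbabilityMeasure ν]

/-- The weak law is applied to the vacancy indicator minus its conditional mean. Along the resulting
subsequence, vanishing of the vacant proportion would force `meanVacancy` to vanish. -/
lemma IsCoxProcess.exists_seq_ae_not_tendsto_average_vacant
    (h : IsCoxProcess (fun ω ↦ countingMeasure (I ω) (fun i ↦ X i ω)) M P)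
    (hI : Measurable I) (hX : ∀ i, Measurable (X i)) (hM : IsErgodicRandomMeasure M P)
    {c : ℝ≥0} (hc : ∫⁻ ω, M ω (Set.Icc 0 1) ∂P = c) (hν : ∫⁻ r, (r : ℝ≥0∞) ∂ν < ∞)
    {σ : ℝ} (hσ : |σ| = 1) :
    ∃ ns : ℕ → ℕ, StrictMono ns ∧ ∀ᵐ p ∂(P.prod (Measure.infinitePi fun _ : ℕ ↦ ν)),
      ¬ Tendsto (fun k ↦ ∫ u in Set.Ioc (0 : ℝ) 1, vacant (markedPoints I X p) (σ * ns k * u))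
        atTop (𝓝 0) := by
  set π := Measure.infinitePi fun _ : ℕ ↦ ν
  let f : Ω × (ℕ → ℝ≥0) → ℝ → ℝ := fun p y ↦
    vacant (markedPoints I X p) y - (vacancy ν y (M p.1)).toReal
  have hvm : Measurable fun q : (Ω × (ℕ → ℝ≥0)) × ℝ ↦ vacant (markedPoints I X q.1) q.2 :=
    measurable_vacant.comp (f := fun q : (Ω × (ℕ → ℝ≥0)) × ℝ ↦ (markedPoints I X q.1, q.2))
      (((measurable_markedPoints hI hX).comp measurable_fst).prodMk measurable_snd)
  have hf : Measurable (Function.uncurry f) := hvm.sub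
    ((measurable_vacancy ν).comp (f := fun q : (Ω × (ℕ → ℝ≥0)) × ℝ ↦ (M q.1.1, q.2))
      ((hM.measurable.comp (measurable_fst.comp measurable_fst)).prodMk
        measurable_snd)).ennreal_toReal
  have hq0 : ∀ y m, 0 ≤ (vacancy ν y m).toReal := fun y m ↦ ENNReal.toReal_nonneg
  have hq1 : ∀ y m, (vacancy ν y m).toReal ≤ 1 := fun y m ↦
    (le_abs_self _).trans (abs_toReal_vacancy_le ν y m)
  have hf1 : ∀ p y, |f p y| ≤ 1 := fun p y ↦ by
    have h0 := hq0 y (M p.1)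
    have h1 := hq1 y (M p.1)
    simp only [f]
    rcases vacant_eq_zero_or_one (markedPoints I X p) y with h | h <;> rw [h, abs_le] <;>
      constructor <;> linarith
  have hφ : Antitone fun t ↦ (overlap ν c t).toReal := fun s t hst ↦
    ENNReal.toReal_mono (overlap_ne_top hν _) (overlap_antitone hst)
  have hφ0 : Tendsto (fun t ↦ (overlap ν c t).toReal) atTop (𝓝 0) := by
    simpa [Function.comp_def] using
      (ENNReal.tendsto_toReal ENNReal.zero_ne_top).comp (tendsto_overlap (c := c) hν)
  obtain ⟨ns, hns, hae⟩ := exists_seq_tendsto_ae_average (P := P.prod π) hf hf1 hφ hφ0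
    (fun y z ↦ h.integral_vacant_sub_mul_le hI hX hM.toIsStationaryRandomMeasure hc hν y z) hσ
  refine ⟨ns, hns, ?_⟩
  have hae2 : ∀ᵐ p ∂(P.prod π),
      ¬ Tendsto (fun k ↦ meanVacancy ν σ (ns k) (M p.1)) atTop (𝓝 0) :=
    Measure.quasiMeasurePreserving_fst.ae (hM.ae_not_tendsto_meanVacancy hc hν hσ hns)
  filter_upwards [hae, hae2] with p hp hp2 hlim
  refine hp2 ?_
  have h3 := hlim.sub hp
  rw [sub_zero] at h3
  refine h3.congr fun k ↦ ?_
  have iv : Integrable (fun u : ℝ ↦ vacant (markedPoints I X p) (σ * ns k * u))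
      (volume.restrict (Set.Ioc (0 : ℝ) 1)) :=
    Integrable.of_bound (hvm.comp (f := fun u : ℝ ↦ (p, σ * ns k * u))
      (by fun_prop)).aestronglyMeasurable 1 (Eventually.of_forall fun u ↦ by
        rcases vacant_eq_zero_or_one (markedPoints I X p) (σ * ns k * u) with h | h <;> simp [h])
  have iq : Integrable (fun u : ℝ ↦ (vacancy ν (σ * ns k * u) (M p.1)).toReal)
      (volume.restrict (Set.Ioc (0 : ℝ) 1)) :=
    Integrable.of_bound ((measurable_vacancy_toReal (M p.1)).comp
      (measurable_const_mul (σ * ns k))).aestronglyMeasurable 1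
      (Eventually.of_forall fun u ↦ abs_toReal_vacancy_le ν _ _)
  simp only [f, meanVacancy]
  rw [integral_sub iv iq, sub_sub_cancel]

lemma IsCoxProcess.ae_not_halfLine_subset
    (h : IsCoxProcess (fun ω ↦ countingMeasure (I ω) (fun i ↦ X i ω)) M P)
    {ρ : ℕ → Ω → ℝ≥0} (hρ : IsIIDMarking I X ρ ν P) (hM : IsErgodicRandomMeasure M P)
    {c : ℝ≥0} (hc : ∫⁻ ω, M ω (Set.Icc 0 1) ∂P = c) (hν : ∫⁻ r, (r : ℝ≥0∞) ∂ν < ∞)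
    {σ : ℝ} (hσ : |σ| = 1) :
    ∀ᵐ ω ∂P, ∀ a, ¬ ∀ y, a ≤ σ * y →
      y ∈ booleanModel (I ω) (fun i ↦ X i ω) (fun i ↦ ρ i ω) := by
  obtain ⟨ns, hns, hae⟩ := h.exists_seq_ae_not_tendsto_average_vacant (ν := ν)
    hρ.measurable_index hρ.measurable_point hM hc hν hσ
  have hIX : Measurable fun ω ↦ (I ω, fun i ↦ X i ω) :=
    hρ.measurable_index.prodMk (measurable_pi_lambda _ hρ.measurable_point)
  have hρm : Measurable fun ω i ↦ ρ i ω := measurable_pi_lambda _ hρ.measurable_mark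
  have hmark : P.map (fun ω i ↦ ρ i ω) = Measure.infinitePi fun _ : ℕ ↦ ν := by
    rw [(iIndepFun_iff_map_fun_eq_infinitePi_map hρ.measurable_mark).1 hρ.iIndepFun_mark]
    congr 1
    ext1 i
    exact (hρ.hasLaw_mark i).map_eq
  -- The given marked process has the same law as the one with fresh radii, so the almost sure
  -- statement transfers.
  have hlaw : P.map (fun ω ↦ ((I ω, fun i ↦ X i ω), fun i ↦ ρ i ω)) =
      (P.prod (Measure.infinitePi fun _ : ℕ ↦ ν)).map (markedPoints I X) := by
    rw [(indepFun_iff_map_prod_eq_prod_map_map hIX.aemeasurable hρm.aemeasurable).1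
      hρ.indepFun_point_mark, hmark]
    conv_lhs => rw [← Measure.map_id (μ := Measure.infinitePi fun _ : ℕ ↦ ν)]
    rw [Measure.map_prod_map _ _ hIX measurable_id]
    rfl
  have hmeas : MeasurableSet {p | ¬ Tendsto
      (fun k ↦ ∫ u in Set.Ioc (0 : ℝ) 1, vacant p (σ * ns k * u)) atTop (𝓝 0)} := by
    refine (measurableSet_tendsto _ fun k ↦ ?_).compl
    exact (StronglyMeasurable.integral_prod_right' (f := fun q :
      ((Set ℕ × (ℕ → ℝ)) × (ℕ → ℝ≥0)) × ℝ ↦ vacant q.1 (σ * ns k * q.2))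
      (measurable_vacant.comp (f := fun q : ((Set ℕ × (ℕ → ℝ)) × (ℕ → ℝ≥0)) × ℝ ↦
        (q.1, σ * ns k * q.2)) (by fun_prop)).stronglyMeasurable).measurable
  have hae' : ∀ᵐ p ∂((P.prod (Measure.infinitePi fun _ : ℕ ↦ ν)).map (markedPoints I X)),
      ¬ Tendsto (fun k ↦ ∫ u in Set.Ioc (0 : ℝ) 1, vacant p (σ * ns k * u)) atTop (𝓝 0) :=
    (ae_map_iff (measurable_markedPoints hρ.measurable_index hρ.measurable_point).aemeasurable
      hmeas).2 hae
  rw [← hlaw] at hae'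
  filter_upwards [ae_of_ae_map (hIX.prodMk hρm).aemeasurable hae'] with ω hω a ha
  exact hω (tendsto_average_vacant_of_halfLine_subset hσ ha hns)

end Cox

theorem proposition2 {Ω : Type*} [MeasurableSpace Ω] (P : Measure Ω) [IsProbabilityMeasure P]
    (Λ : Ω → Measure ℝ) (hΛ : IsErgodicRandomMeasure Λ P)
    (hΛ1 : ∫⁻ ω, Λ ω (Set.Icc 0 1) ∂P = 1)
    (lam : ℝ≥0) (hlam : 0 < lam)
    (I : Ω → Set ℕ) (X : ℕ → Ω → ℝ) (ρ : ℕ → Ω → ℝ≥0)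
    (hX : IsCoxProcess (fun ω => countingMeasure (I ω) (fun i => X i ω)) (fun ω => lam • Λ ω) P)
    (ν : Measure ℝ≥0) (hρ : IsIIDMarking I X ρ ν P)
    (hν : ∫⁻ r, (r : ℝ≥0∞) ∂ν < ∞) :
    ∀ᵐ ω ∂P, ¬ HasUnboundedComponent
      (booleanModel (I ω) (fun i => X i ω) (fun i => ρ i ω)) := by
  have : IsProbabilityMeasure ν := (hρ.hasLaw_mark 0).isProbabilityMeasure_iff.1 inferInstance
  have hM := hΛ.const_smul lam
  have hc : ∫⁻ ω, (lam • Λ ω) (Set.Icc 0 1) ∂P = lam := by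
    simp only [Measure.smul_apply, ENNReal.smul_def, smul_eq_mul]
    rw [lintegral_const_mul' _ _ ENNReal.coe_ne_top, hΛ1, mul_one]
  filter_upwards [hX.ae_not_halfLine_subset hρ hM hc hν (σ := 1) (by simp),
    hX.ae_not_halfLine_subset hρ hM hc hν (σ := -1) (by simp)] with ω h1 h2 hC
  obtain ⟨a, ha | ha⟩ := hC.exists_halfLine_subset
  exacts [h1 a ha, h2 a ha]
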